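/- Let $\Omega\subset\mathbb R^3$ be open, let $\rho:\Omega\to(0,\infty)$ be continuous, and let $L^2_\rho(\Lambda^1\Omega)$ be the set of $1$-forms $v\in L^1_{loc}(\Lambda^1\Omega)$ with $\int_\Omega\rho|v|^2\,dx<\infty$. For $\Phi\in L^2_\rho(\Lambda^1\Omega)$ consider on $L^2_\rho(\Lambda^1\Omega)$ the functional $$\mathcal G(v)=\int_\Omega\rho\Big(\frac{|v|^2}2-v\cdot\Phi+\frac12|dv|\Big),$$ where $|dv|$ is the total variation measure of the distributional exterior derivative $dv$, and $\mathcal G(v)=+\infty$ if $dv$ is not a Radon measure or $\rho$ is not $|dv|$-integrable. Assume that there are $\tilde\Omega\subset[0,\infty)\times\mathbb R$, $\tilde\rho:\tilde\Omega\to(0,\infty)$ and $\phi:\tilde\Omega\to\mathbb R$ such that $$\Omega=\{(r\cos\alpha,r\sin\alpha,z):(r,z)\in\tilde\Omega,\ \alpha\in\mathbb R\},$$ and, for all $(r,z)\in\tilde\Omega$ and $\alpha\in\mathbb R$, $\rho(r\cos\alpha,r\sin\alpha,z)=\tilde\rho(r,z)$ and, if $r>0$, $\Phi(r\cos\alpha,r\sin\alpha,z)=\phi(r,z)\,d\theta$,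 where $d\theta=(x_1dx^2-x_2dx^1)/(x_1^2+x_2^2)$. Let $$\mathcal G^{red}(w)=\frac12\int_{\tilde\Omega}\tilde\rho\Big(|\nabla w|+\frac{(w-\phi)^2}r\Big)\,dr\,dz$$ for measurable $w:\tilde\Omega\to\mathbb R$ with $\int_{\tilde\Omega}\frac{\tilde\rho}r w^2\,dr\,dz<\infty$, where $|\nabla w|$ is the total variation measure of the distributional gradient of $w$ in the interior of $\tilde\Omega$, and $\mathcal G^{red}(w)=+\infty$ if $\nabla w$ is not a Radon measure or $\tilde\rho$ is not $|\nabla w|$-integrable. Then $\mathcal G$ has a unique minimizer $v_0$ in $L^2_\rho(\Lambda^1\Omega)$, $\mathcal G^{red}$ has a unique minimizer $w_0$ among the measurable functions $w$ with $\int_{\tilde\Omega}\frac{\tilde\rho}r w^2\,dr\,dz<\infty$ (uniqueness up to almost everywhere equality in both cases), and $v_0=w_0(r,z)\,d\theta$ almost everywhere in $\Omega$. -/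

import Mathlib

open MeasureTheory
open scoped ENNReal ContDiff

noncomputable section

/-- `ℝ³`.  A `1`-form `v₁ dx¹ + v₂ dx² + v₃ dx³` on a subset of `ℝ³` is represented by its coefficient
field `x ↦ (v₁ x, v₂ x, v₃ x)`, so that `|v|` and `v · w` are the Euclidean norm and inner product. -/
abbrev E3 : Type := EuclideanSpace ℝ (Fin 3)

/-- The point of `ℝ³` with cylindrical coordinates `(r, α, z)`. -/
def cyl (r α z : ℝ) : E3 := !₂[r * Real.cos α, r * Real.sin α, z]

/-- The `1`-form `dθ = (x₁ dx² - x₂ dx¹) / (x₁² + x₂²)`, meaningful off the axis `x₁ = x₂ = 0`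
(a Lebesgue null set). -/
def dtheta (x : E3) : E3 :=
  !₂[-(x 1) / (x 0 ^ 2 + x 1 ^ 2), x 0 / (x 0 ^ 2 + x 1 ^ 2), 0]

/-- The `1`-form `w(r, z) dθ` on `ℝ³`. -/
def mulDtheta (w : ℝ × ℝ → ℝ) (x : E3) : E3 :=
  w (Real.sqrt (x 0 ^ 2 + x 1 ^ 2), x 2) • dtheta x

/-- `ψ ∈ C_c^∞(U; F)`. -/
def IsTest {E F : Type*} [NormedAddCommGroup E] [NormedSpace ℝ E]
    [NormedAddCommGroup F] [NormedSpace ℝ F] (U : Set E) (ψ : E → F) : Prop :=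
  ContDiff ℝ ∞ ψ ∧ HasCompactSupport ψ ∧ tsupport ψ ⊆ U

/-- The partial derivative `∂_j ψ_i` at `x`. -/
def pd (j i : Fin 3) (ψ : E3 → E3) (x : E3) : ℝ :=
  fderiv ℝ ψ x (EuclideanSpace.single j 1) i

/-- The formal adjoint `d^*` of the exterior derivative on `2`-forms in `ℝ³`.  The `2`-form
`ψ₁ dx²∧dx³ + ψ₂ dx³∧dx¹ + ψ₃ dx¹∧dx²` is represented by its coefficients `(ψ₁, ψ₂, ψ₃)` in this
orthonormal basis; in terms of these, `d^* = ⋆d⋆` is the curl. -/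
def dstar (ψ : E3 → E3) (x : E3) : E3 :=
  !₂[pd 1 2 ψ x - pd 2 1 ψ x, pd 2 0 ψ x - pd 0 2 ψ x, pd 0 1 ψ x - pd 1 0 ψ x]

/-- `∫_Ω ρ |dv|`, the integral of `ρ` (positive and continuous on the open set `Ω`) against the
variation measure `|dv|` of the distributional exterior derivative `dv`, defined by duality:
the supremum of `⟨dv, ψ⟩ = ∫_Ω v · d^*ψ` over all test `2`-forms `ψ` with `|ψ| ≤ ρ`.
It is `+∞` if `dv` is not a Radon measure on `Ω` or if `ρ` is not `|dv|`-integrable. -/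
def weightedVar (Ω : Set E3) (ρ : E3 → ℝ) (v : E3 → E3) : ℝ≥0∞ :=
  ⨆ (ψ : E3 → E3) (_ : IsTest Ω ψ ∧ ∀ x ∈ Ω, ‖ψ x‖ ≤ ρ x),
    ENNReal.ofReal (∫ x in Ω, inner ℝ (v x) (dstar ψ x))

/-- `v ∈ L²_ρ(Λ¹Ω)`: `v ∈ L¹_loc(Λ¹Ω)` and `∫_Ω ρ |v|² < ∞`. -/
def MemL2rho (Ω : Set E3) (ρ : E3 → ℝ) (v : E3 → E3) : Prop :=
  LocallyIntegrableOn v Ω volume ∧ ∫⁻ x in Ω, ENNReal.ofReal (ρ x * ‖v x‖ ^ 2) < ⊤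

/-- `𝒢(v) = ∫_Ω ρ (|v|²/2 - v · Φ + |dv|/2) ∈ (-∞, +∞]`, for `v, Φ ∈ L²_ρ(Λ¹Ω)`. -/
def energyG (Ω : Set E3) (ρ : E3 → ℝ) (Φ v : E3 → E3) : EReal :=
  ((∫ x in Ω, ρ x * (‖v x‖ ^ 2 / 2 - inner ℝ (v x) (Φ x)) : ℝ) : EReal) +
    (((1 / 2 : ℝ≥0∞) * weightedVar Ω ρ v : ℝ≥0∞) : EReal)

/-- `v` minimizes `𝒢` in `L²_ρ(Λ¹Ω)`. -/
def IsMinimizerG (Ω : Set E3) (ρ : E3 → ℝ) (Φ v : E3 → E3) : Prop :=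
  MemL2rho Ω ρ v ∧ ∀ u : E3 → E3, MemL2rho Ω ρ u → energyG Ω ρ Φ v ≤ energyG Ω ρ Φ u

/-- The divergence of a vector field on the `(r, z)` plane. -/
def div2 (ξ : ℝ × ℝ → EuclideanSpace ℝ (Fin 2)) (p : ℝ × ℝ) : ℝ :=
  fderiv ℝ ξ p (1, 0) 0 + fderiv ℝ ξ p (0, 1) 1

/-- `∫_Ω̃ ρ̃ |∇w|`, the integral of `ρ̃` against the variation measure of the distributional
gradient of `w` in (the interior of) `Ω̃ ⊆ [0,∞) × ℝ`, defined by duality; `+∞` if `∇w` is not a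
Radon measure or `ρ̃` is not `|∇w|`-integrable. -/
def weightedVar2 (Ωt : Set (ℝ × ℝ)) (ρt : ℝ × ℝ → ℝ) (w : ℝ × ℝ → ℝ) : ℝ≥0∞ :=
  ⨆ (ξ : ℝ × ℝ → EuclideanSpace ℝ (Fin 2))
    (_ : IsTest (interior Ωt) ξ ∧ ∀ p ∈ interior Ωt, ‖ξ p‖ ≤ ρt p),
    ENNReal.ofReal (∫ p in Ωt, w p * div2 ξ p)

/-- The (measurable) functions `w : Ω̃ → ℝ` with `∫_Ω̃ (ρ̃ / r) w² dr dz < ∞`. -/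
def MemL2red (Ωt : Set (ℝ × ℝ)) (ρt : ℝ × ℝ → ℝ) (w : ℝ × ℝ → ℝ) : Prop :=
  AEStronglyMeasurable w (volume.restrict Ωt) ∧
    ∫⁻ p in Ωt, ENNReal.ofReal (ρt p / p.1 * w p ^ 2) < ⊤

/-- `𝒢^red(w) = ½ ∫_Ω̃ ρ̃ (|∇w| + (w - φ)² / r) dr dz ∈ [0, +∞]`. -/
def energyGred (Ωt : Set (ℝ × ℝ)) (ρt φ w : ℝ × ℝ → ℝ) : ℝ≥0∞ :=
  (1 / 2) * (weightedVar2 Ωt ρt w +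
    ∫⁻ p in Ωt, ENNReal.ofReal (ρt p * ((w p - φ p) ^ 2 / p.1)))

/-- `w` minimizes `𝒢^red` among the functions with `∫_Ω̃ (ρ̃ / r) w² dr dz < ∞`. -/
def IsMinimizerGred (Ωt : Set (ℝ × ℝ)) (ρt φ w : ℝ × ℝ → ℝ) : Prop :=
  MemL2red Ωt ρt w ∧
    ∀ u : ℝ × ℝ → ℝ, MemL2red Ωt ρt u → energyGred Ωt ρt φ w ≤ energyGred Ωt ρt φ u

end

/-! Both problems are quadratic-plus-support-function problems in a Hilbert space. With u = ρ^{1/2}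
v and f = ρ^{1/2} Φ, the functional 2𝒢 becomes, up to a constant, ‖u - f‖² + sup ⟨u, k⟩, the
supremum running over the convex set of k = ρ^{-1/2} d^*ψ. The reduced functional has the same form,
with the weight ρt/r in place of ρ and div ξ in place of d^*ψ.

For a convex set D, let p be the projection of 2f onto the closure of D. Then f - p/2 is the unique
minimizer: by the variational inequality its support function is at most ⟨f - p/2, p⟩, and expanding
squares gives an energy gap of at least ‖u - (f - p/2)‖² for every competitor u
(`exists_isDualCertificate`, `IsDualCertificate.energy_add_sq_le`).

The projection is carried out only in the (r, z) half-plane, and the resulting p is shown to lift to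
a certificate for the spatial problem. Thus no symmetrization of spatial competitors is needed, and
both minimizers come from the same p, which gives v₀ = w₀ dθ. The lift W ↦ r^{1/2} W dθ multiplies
L² norms by (2π)^{1/2}. Two facts make it carry certificates to certificates. Rotating a planar
field ξ gives a spatial 2-form of the same length with d^* equal to r (div ξ) dθ (`dstar_liftTest`),
so the lifted p is still a limit of admissible elements. Conversely, the variation of w dθ is at
most 2π times that of w (`weightedVar_mulDtheta_le`): a spatial test form is cut into meridian
half-planes, each slice is a planar test field, and the slices are integrated over the angle. A
slice may reach the axis, where planar test fields must vanish; a cutoff near r = 0 is harmless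
because w²/r is integrable there (`integral_mul_div2_le_toReal_weightedVar2`). -/

noncomputable section

/-! ### Convex duality in L² by projection. -/

section DualCertificate

variable {X F : Type*} [MeasurableSpace X] [NormedAddCommGroup F] [InnerProductSpace ℝ F]

/-- A dual certificate for the minimization of `‖u - f‖² + sup_{k ∈ D} ⟨u, k⟩` in `L²(μ; F)`:
`p` lies in the `L²`-closure of `D`, and the supremum for `f - p / 2` is attained at `p`. -/
structure IsDualCertificate (μ : Measure X) (D : Set (X → F)) (f p : X → F) : Prop where
  memLp : MemLp p 2 μ
  approx : ∀ ε : ℝ, 0 < ε → ∃ k ∈ D, eLpNorm (p - k) 2 μ < ENNReal.ofReal ε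
  inner_le : ∀ k ∈ D, ∫ x, inner ℝ (f x - (1 / 2 : ℝ) • p x) (k x) ∂μ ≤
    ∫ x, inner ℝ (f x - (1 / 2 : ℝ) • p x) (p x) ∂μ

lemma inner_toLp_eq_integral {μ : Measure X} {f g : X → F} (hf : MemLp f 2 μ) (hg : MemLp g 2 μ) :
    inner ℝ (hf.toLp f) (hg.toLp g) = ∫ x, inner ℝ (f x) (g x) ∂μ := by
  rw [L2.inner_def]
  refine integral_congr_ae ?_
  filter_upwards [hf.coeFn_toLp, hg.coeFn_toLp] with x h1 h2
  rw [h1, h2]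

lemma norm_toLp_sq_eq_integral {μ : Measure X} {f : X → F} (hf : MemLp f 2 μ) :
    ‖hf.toLp f‖ ^ 2 = ∫ x, ‖f x‖ ^ 2 ∂μ := by
  rw [← real_inner_self_eq_norm_sq, inner_toLp_eq_integral]
  simp

/-- Projecting onto a convex set yields a dual certificate. -/
theorem exists_isDualCertificate [CompleteSpace F] {μ : Measure X} {D : Set (X → F)}
    (hD : ∀ k ∈ D, MemLp k 2 μ) (hconv : Convex ℝ D) (hne : D.Nonempty) {f : X → F}
    (hf : MemLp f 2 μ) : ∃ p, IsDualCertificate μ D f p := by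
  let K : Set (Lp F 2 μ) := {g | ∃ k, ∃ hk : k ∈ D, g = (hD k hk).toLp k}
  have hKc : Convex ℝ K := by
    rintro _ ⟨k, hk, rfl⟩ _ ⟨l, hl, rfl⟩ a b ha hb hab
    exact ⟨a • k + b • l, hconv hk hl ha hb hab, rfl⟩
  have hKne : K.Nonempty := hne.elim fun k hk => ⟨_, k, hk, rfl⟩
  -- The projected point is 2f: the variational inequality ⟨2f - p, k - p⟩ ≤ 0 is then twice the
  -- required bound for f - p/2.
  obtain ⟨p, hp, hmin⟩ := exists_norm_eq_iInf_of_complete_convex hKne.closure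
    isClosed_closure.isComplete hKc.closure ((2 : ℝ) • hf.toLp f)
  rw [norm_eq_iInf_iff_real_inner_le_zero hKc.closure hp] at hmin
  have hpm : MemLp (p : X → F) 2 μ := Lp.memLp p
  have hv : MemLp (fun x => f x - (1 / 2 : ℝ) • p x) 2 μ := hf.sub (hpm.const_smul _)
  have hvL : hv.toLp _ = hf.toLp f - (1 / 2 : ℝ) • p := by
    have : hv.toLp _ = hf.toLp f - (1 / 2 : ℝ) • hpm.toLp p := rfl
    rw [this, Lp.toLp_coeFn]
  refine ⟨p, hpm, fun ε hε => ?_, fun k hk => ?_⟩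
  · obtain ⟨_, ⟨k, hk, rfl⟩, hd⟩ := Metric.mem_closure_iff.1 hp ε hε
    refine ⟨k, hk, ?_⟩
    have : p = hpm.toLp p := (Lp.toLp_coeFn p hpm).symm
    rw [this, dist_eq_norm, ← MemLp.toLp_sub, Lp.norm_toLp] at hd
    exact (ENNReal.lt_ofReal_iff_toReal_lt (hpm.sub (hD k hk)).2.ne).2 hd
  · have h := hmin _ (subset_closure ⟨k, hk, rfl⟩)
    rw [← inner_toLp_eq_integral hv (hD k hk), ← inner_toLp_eq_integral hv hpm, hvL,
      Lp.toLp_coeFn]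
    have e : (2 : ℝ) • hf.toLp f - p = (2 : ℝ) • (hf.toLp f - (1 / 2 : ℝ) • p) := by
      rw [smul_sub, smul_smul]; norm_num
    rw [e, inner_smul_left, inner_sub_right] at h
    simp only [conj_trivial] at h
    linarith

/-- Quadratic growth of the energy at the candidate given by a dual certificate. -/
theorem IsDualCertificate.energy_add_sq_le {μ : Measure X} {D : Set (X → F)}
    {f p u : X → F} (h : IsDualCertificate μ D f p) (hD : ∀ k ∈ D, MemLp k 2 μ)
    (hf : MemLp f 2 μ) (hu : MemLp u 2 μ) {T : ℝ} (hT : ∀ k ∈ D, ∫ x, inner ℝ (u x) (k x) ∂μ ≤ T) :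
    ∫ x, ‖(f x - (1 / 2 : ℝ) • p x) - f x‖ ^ 2 ∂μ +
        ∫ x, inner ℝ (f x - (1 / 2 : ℝ) • p x) (p x) ∂μ +
        ∫ x, ‖u x - (f x - (1 / 2 : ℝ) • p x)‖ ^ 2 ∂μ ≤ ∫ x, ‖u x - f x‖ ^ 2 ∂μ + T := by
  have hp := h.memLp
  have hv : MemLp (fun x => f x - (1 / 2 : ℝ) • p x) 2 μ := hf.sub (hp.const_smul _)
  -- The bound T passes from D to its limit p; the `+ 1` in the tolerance covers u = 0.
  have hup : inner ℝ (hu.toLp u) (hp.toLp p) ≤ T := by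
    refine le_of_forall_pos_le_add fun ε hε => ?_
    obtain ⟨k, hk, hkd⟩ := h.approx (ε / (‖hu.toLp u‖ + 1)) (by positivity)
    have hd : ‖hp.toLp p - (hD k hk).toLp k‖ < ε / (‖hu.toLp u‖ + 1) := by
      rw [← MemLp.toLp_sub, Lp.norm_toLp]
      exact (ENNReal.lt_ofReal_iff_toReal_lt (hp.sub (hD k hk)).2.ne).1 hkd
    have h1 := hT k hk
    rw [← inner_toLp_eq_integral hu (hD k hk)] at h1
    have h2 := real_inner_le_norm (hu.toLp u) (hp.toLp p - (hD k hk).toLp k)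
    rw [inner_sub_right] at h2
    have h3 : ‖hu.toLp u‖ * ‖hp.toLp p - (hD k hk).toLp k‖ ≤ ε := by
      rw [lt_div_iff₀ (by positivity)] at hd
      nlinarith [norm_nonneg (hp.toLp p - (hD k hk).toLp k)]
    linarith
  have i1 : ∫ x, ‖(f x - (1 / 2 : ℝ) • p x) - f x‖ ^ 2 ∂μ = _ :=
    (norm_toLp_sq_eq_integral (hv.sub hf)).symm
  have i2 : ∫ x, ‖u x - (f x - (1 / 2 : ℝ) • p x)‖ ^ 2 ∂μ = _ :=
    (norm_toLp_sq_eq_integral (hu.sub hv)).symm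
  have i3 : ∫ x, ‖u x - f x‖ ^ 2 ∂μ = _ := (norm_toLp_sq_eq_integral (hu.sub hf)).symm
  rw [i1, i2, i3, ← inner_toLp_eq_integral hv hp]
  have e1 : hv.toLp _ = hf.toLp f - (1 / 2 : ℝ) • hp.toLp p := rfl
  rw [MemLp.toLp_sub hv hf, MemLp.toLp_sub hu hv, MemLp.toLp_sub hu hf, e1]
  -- With v = f - p/2, expansion gives ‖u - f‖² + ⟨u, p⟩ = ‖v - f‖² + ⟨v, p⟩ + ‖u - v‖², and `hup`
  -- replaces ⟨u, p⟩ by T.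
  set a := hf.toLp f
  set b := hp.toLp p
  set c := hu.toLp u
  simp only [← real_inner_self_eq_norm_sq, inner_sub_left, inner_sub_right, inner_smul_left,
    inner_smul_right, conj_trivial]
  have s1 := real_inner_comm a b
  have s2 := real_inner_comm a c
  have s3 := real_inner_comm b c
  linarith

end DualCertificate

/-! ### Cylindrical coordinates and bodies of revolution. -/

section Cylindrical

/-- The map `((r, z), α) ↦ (r cos α, r sin α, z)`. -/
def cylMap (y : (ℝ × ℝ) × ℝ) : E3 := cyl y.1.1 y.2 y.1.2

/-- The coordinates `(r, z)` of a point of `ℝ³`. -/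
def meridian (x : E3) : ℝ × ℝ := (Real.sqrt (x 0 ^ 2 + x 1 ^ 2), x 2)

/-- The measure `r dr dz` on a subset of the `(r, z)` plane. -/
def radialMeasure (s : Set (ℝ × ℝ)) : Measure (ℝ × ℝ) :=
  (volume.restrict s).withDensity fun p => ENNReal.ofReal p.1

instance (s : Set (ℝ × ℝ)) : SFinite (radialMeasure s) := by
  unfold radialMeasure; infer_instance

@[simp] lemma cyl_zero (r α z : ℝ) : cyl r α z 0 = r * Real.cos α := rfl
@[simp] lemma cyl_one (r α z : ℝ) : cyl r α z 1 = r * Real.sin α := rfl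
@[simp] lemma cyl_two (r α z : ℝ) : cyl r α z 2 = z := rfl

lemma continuous_cylMap : Continuous cylMap := by
  unfold cylMap cyl
  refine (PiLp.continuous_toLp 2 _).comp (continuous_pi fun i => ?_)
  fin_cases i <;> simp <;> fun_prop

lemma continuous_meridian : Continuous meridian := by
  unfold meridian; fun_prop

lemma meridian_cyl {r : ℝ} (hr : 0 ≤ r) (α z : ℝ) : meridian (cyl r α z) = (r, z) := by
  have : (r * Real.cos α) ^ 2 + (r * Real.sin α) ^ 2 = r ^ 2 := by
    have := Real.cos_sq_add_sin_sq α
    linear_combination r ^ 2 * this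
  simp [meridian, this, Real.sqrt_sq hr]

lemma exists_eq_cyl (x : E3) : ∃ α, x = cyl (meridian x).1 α (meridian x).2 := by
  refine ⟨Complex.arg ⟨x 0, x 1⟩, ?_⟩
  have hn : ‖(⟨x 0, x 1⟩ : ℂ)‖ = Real.sqrt (x 0 ^ 2 + x 1 ^ 2) := by
    rw [Complex.norm_def, Complex.normSq_mk]; ring_nf
  ext i
  fin_cases i
  · have := Complex.norm_mul_cos_arg ⟨x 0, x 1⟩
    rw [hn] at this
    simpa [cyl, meridian] using this.symm
  · have := Complex.norm_mul_sin_arg ⟨x 0, x 1⟩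
    rw [hn] at this
    simpa [cyl, meridian] using this.symm
  · simp [cyl, meridian]

/-- The coordinate z comes first so that Fubini leaves, for each fixed z, an integral over the (x₁,
x₂) plane. -/
lemma measurePreserving_coords :
    MeasurePreserving (fun y : ℝ × ℝ × ℝ => (!₂[y.2.1, y.2.2, y.1] : E3)) := by
  have h1 := (volume_preserving_piFinSuccAbove (fun _ : Fin 3 => ℝ) 2).symm
  have h2 := (MeasurePreserving.id (volume : Measure ℝ)).prod (volume_preserving_finTwoArrow ℝ).symm
  have h3 := (PiLp.volume_preserving_toLp (Fin 3)).comp (h1.comp h2)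
  have he : (fun y : ℝ × ℝ × ℝ => (!₂[y.2.1, y.2.2, y.1] : E3)) = WithLp.toLp 2 ∘
      (MeasurableEquiv.piFinSuccAbove (fun _ : Fin 3 => ℝ) 2).symm ∘
        Prod.map id MeasurableEquiv.finTwoArrow.symm := by
    funext y
    ext i
    fin_cases i <;> rfl
  rw [he]
  exact h3

lemma lintegral_eq_lintegral_cyl {f : E3 → ℝ≥0∞} (hf : Measurable f) :
    ∫⁻ x, f x = ∫⁻ y, f (cylMap y)
      ∂(radialMeasure {p | 0 < p.1}).prod (volume.restrict (Set.Ioo (-Real.pi) Real.pi)) := by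
  have hc : Measurable cylMap := continuous_cylMap.measurable
  have hset : ({p | 0 < p.1} : Set (ℝ × ℝ)) = Set.Ioi 0 ×ˢ Set.univ := by ext; simp
  have hcoord := measurePreserving_coords
  -- On both sides z is made the outermost variable; what remains for fixed z is the plane polar
  -- coordinate formula.
  rw [← hcoord.lintegral_comp hf, Measure.volume_eq_prod,
    lintegral_prod (fun y : ℝ × ℝ × ℝ => f !₂[y.2.1, y.2.2, y.1])
      (hf.comp hcoord.measurable).aemeasurable,
    lintegral_prod (fun y => f (cylMap y)) (hf.comp hc).aemeasurable, radialMeasure,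
    lintegral_withDensity_eq_lintegral_mul _ (by fun_prop)
      (Measurable.lintegral_prod_right' (f := fun y => f (cylMap y)) (hf.comp hc)),
    hset, Measure.volume_eq_prod, ← Measure.prod_restrict, Measure.restrict_univ,
    lintegral_prod_symm _ (by
      refine (Measurable.mul (by fun_prop) ?_).aemeasurable
      exact Measurable.lintegral_prod_right' (f := fun y => f (cylMap y)) (hf.comp hc))]
  refine lintegral_congr fun z => ?_
  rw [← Measure.volume_eq_prod,
    ← lintegral_comp_polarCoord_symm (fun y : ℝ × ℝ => f !₂[y.1, y.2, z]), polarCoord_target,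
    Measure.volume_eq_prod, ← Measure.prod_restrict, lintegral_prod]
  · refine lintegral_congr fun r => ?_
    simp only [Pi.mul_apply, smul_eq_mul]
    rw [lintegral_const_mul]
    · rfl
    · exact hf.comp (hc.comp (measurable_const.prodMk measurable_id :
        Measurable fun α : ℝ => ((r, z), α)))
  · refine Measurable.aemeasurable (Measurable.mul (by fun_prop) ?_)
    exact hf.comp (hcoord.measurable.comp (measurable_const.prodMk
      continuous_polarCoord_symm.measurable))

lemma measurePreserving_cylMap_univ :
    MeasurePreserving cylMap
      ((radialMeasure {p | 0 < p.1}).prod (volume.restrict (Set.Ioo (-Real.pi) Real.pi))) := by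
  refine ⟨continuous_cylMap.measurable, Measure.ext fun s hs => ?_⟩
  rw [Measure.map_apply continuous_cylMap.measurable hs,
    ← lintegral_indicator_one hs, lintegral_eq_lintegral_cyl (measurable_one.indicator hs),
    ← lintegral_indicator_one (continuous_cylMap.measurable hs)]
  rfl

lemma ae_fst_ne_zero : ∀ᵐ p : ℝ × ℝ, p.1 ≠ 0 := by
  rw [ae_iff]
  have : ({a : ℝ × ℝ | ¬a.1 ≠ 0}) = {0} ×ˢ Set.univ := by ext; simp
  rw [this, Measure.volume_eq_prod, Measure.prod_prod]
  simp

/-- `Ω` is the body of revolution of `Ωt`. -/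
structure IsRevolution (Ω : Set E3) (Ωt : Set (ℝ × ℝ)) : Prop where
  isOpen : IsOpen Ω
  nonneg : ∀ p ∈ Ωt, 0 ≤ p.1
  eq : Ω = {x | ∃ r z α : ℝ, (r, z) ∈ Ωt ∧ x = cyl r α z}

namespace IsRevolution

variable {Ω : Set E3} {Ωt : Set (ℝ × ℝ)}

lemma cyl_mem_iff (h : IsRevolution Ω Ωt) {r : ℝ} (hr : 0 ≤ r) (α z : ℝ) :
    cyl r α z ∈ Ω ↔ (r, z) ∈ Ωt := by
  rw [h.eq]
  refine ⟨?_, fun hp => ⟨r, z, α, hp, rfl⟩⟩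
  rintro ⟨r', z', α', hp, he⟩
  have := congrArg meridian he
  rw [meridian_cyl hr, meridian_cyl (h.nonneg _ hp)] at this
  rwa [this]

lemma mem_iff (h : IsRevolution Ω Ωt) (x : E3) : x ∈ Ω ↔ meridian x ∈ Ωt := by
  obtain ⟨α, hα⟩ := exists_eq_cyl x
  have hr : 0 ≤ (meridian x).1 := Real.sqrt_nonneg _
  rw [← Prod.mk.eta (p := meridian x), ← h.cyl_mem_iff hr α, ← hα]

/-- The section at angle 0 recovers Ωt from the open set Ω; measurability of Ωt and the description
of its interior rest on this section. -/
lemma eq_inter (h : IsRevolution Ω Ωt) :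
    Ωt = {p | 0 ≤ p.1} ∩ (fun p : ℝ × ℝ => cylMap (p, 0)) ⁻¹' Ω := by
  ext p
  refine ⟨fun hp => ⟨h.nonneg p hp, (h.cyl_mem_iff (h.nonneg p hp) 0 p.2).2 hp⟩, fun hp => ?_⟩
  exact (h.cyl_mem_iff hp.1 0 p.2).1 hp.2

lemma measurableSet (h : IsRevolution Ω Ωt) : MeasurableSet Ωt := by
  rw [h.eq_inter]
  exact (measurableSet_le measurable_const measurable_fst).inter
    (h.isOpen.measurableSet.preimage (continuous_cylMap.comp (by fun_prop)).measurable)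

/-- Points on the axis can be interior to Ω in space but never to Ωt in the plane. Planar test
fields therefore vanish near the axis while spatial ones need not, which is why a cutoff argument is
needed. -/
lemma interior_eq (h : IsRevolution Ω Ωt) : interior Ωt = {p | p ∈ Ωt ∧ 0 < p.1} := by
  apply subset_antisymm
  · intro p hp
    refine ⟨interior_subset hp, ?_⟩
    have h1 : interior Ωt ⊆ interior (Set.Ici (0 : ℝ) ×ˢ Set.univ) :=
      interior_mono fun q hq => ⟨h.nonneg q hq, trivial⟩
    have := h1 hp
    rw [interior_prod_eq, interior_Ici] at this
    exact this.1
  · have ho : IsOpen ({p : ℝ × ℝ | 0 < p.1} ∩ (fun p : ℝ × ℝ => cylMap (p, 0)) ⁻¹' Ω) :=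
      (isOpen_lt continuous_const continuous_fst).inter
        (h.isOpen.preimage (continuous_cylMap.comp (by fun_prop)))
    refine interior_maximal ?_ ho |>.trans' ?_
    · rintro p ⟨hp, hq⟩
      exact (h.cyl_mem_iff (le_of_lt hp) 0 p.2).1 hq
    · rintro p ⟨hp, hq⟩
      exact ⟨hq, (h.cyl_mem_iff hq.le 0 p.2).2 hp⟩

/-- Integration in cylindrical coordinates on a body of revolution. -/
lemma measurePreserving_cylMap (h : IsRevolution Ω Ωt) :
    MeasurePreserving cylMap
      ((radialMeasure Ωt).prod (volume.restrict (Set.Ioo (-Real.pi) Real.pi)))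
      (volume.restrict Ω) := by
  have h1 := measurePreserving_cylMap_univ.restrict_preimage h.isOpen.measurableSet
  have h2 : radialMeasure Ωt = (radialMeasure {p | 0 < p.1}).restrict Ωt := by
    rw [radialMeasure, radialMeasure, restrict_withDensity h.measurableSet,
      Measure.restrict_restrict h.measurableSet]
    congr 1
    refine Measure.restrict_congr_set ?_
    filter_upwards [ae_fst_ne_zero] with p hp
    refine propext ⟨fun hm => ⟨hm, lt_of_le_of_ne (h.nonneg p hm) hp.symm⟩, fun hm => hm.1⟩
  have hpos : ∀ᵐ y ∂((radialMeasure {p | 0 < p.1}).prod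
      (volume.restrict (Set.Ioo (-Real.pi) Real.pi))), 0 < y.1.1 := by
    refine Measure.quasiMeasurePreserving_fst.ae (p := fun p : ℝ × ℝ => 0 < p.1) ?_
    refine (withDensity_absolutelyContinuous _ _).ae_le ?_
    exact ae_restrict_mem (measurableSet_lt measurable_const measurable_fst)
  suffices he : (radialMeasure Ωt).prod (volume.restrict (Set.Ioo (-Real.pi) Real.pi)) = _ from
    he ▸ h1
  rw [h2, ← Measure.restrict_univ (μ := volume.restrict (Set.Ioo (-Real.pi) Real.pi)),
    Measure.prod_restrict, Measure.restrict_univ]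
  refine Measure.restrict_congr_set ?_
  filter_upwards [hpos] with y hy
  exact propext ((and_iff_left trivial).trans (h.cyl_mem_iff hy.le y.2 y.1.2).symm)

/-- The image of the Lebesgue measure on `Ω` under `x ↦ (r, z)` is `2π r dr dz`. -/
lemma map_meridian (h : IsRevolution Ω Ωt) :
    (volume.restrict Ω).map meridian = ENNReal.ofReal (2 * Real.pi) • radialMeasure Ωt := by
  rw [← h.measurePreserving_cylMap.map_eq,
    Measure.map_map continuous_meridian.measurable continuous_cylMap.measurable]
  have hmem : ∀ᵐ p ∂radialMeasure Ωt, 0 ≤ p.1 := by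
    refine (withDensity_absolutelyContinuous _ _).ae_le ?_
    filter_upwards [ae_restrict_mem h.measurableSet] with p hp using h.nonneg p hp
  have : meridian ∘ cylMap =ᵐ[(radialMeasure Ωt).prod
      (volume.restrict (Set.Ioo (-Real.pi) Real.pi))] Prod.fst := by
    filter_upwards [Measure.quasiMeasurePreserving_fst.ae hmem] with y hy
    exact meridian_cyl hy _ _
  rw [Measure.map_congr this, Measure.map_fst_prod, Measure.restrict_apply_univ,
    Real.volume_Ioo]
  ring_nf

lemma ae_pos (h : IsRevolution Ω Ωt) : ∀ᵐ p ∂volume.restrict Ωt, 0 < p.1 := by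
  filter_upwards [ae_restrict_mem h.measurableSet, ae_restrict_of_ae ae_fst_ne_zero] with p hp hne
  exact lt_of_le_of_ne (h.nonneg p hp) hne.symm

lemma ae_meridian_pos (h : IsRevolution Ω Ωt) :
    ∀ᵐ x ∂volume.restrict Ω, 0 < (meridian x).1 := by
  refine ae_of_ae_map (p := fun p : ℝ × ℝ => 0 < p.1) continuous_meridian.aemeasurable ?_
  rw [h.map_meridian]
  exact Measure.ae_smul_measure ((withDensity_absolutelyContinuous _ _).ae_le h.ae_pos) _

end IsRevolution

end Cylindrical

/-! ### Absorbing a weight into an unweighted L² space. -/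

section WeightedL2

variable {X F : Type*} [MeasurableSpace X] [NormedAddCommGroup F] [InnerProductSpace ℝ F]

lemma norm_sqrt_smul_sq {a : ℝ} (ha : 0 ≤ a) (v : F) : ‖Real.sqrt a • v‖ ^ 2 = a * ‖v‖ ^ 2 := by
  rw [norm_smul, mul_pow, Real.norm_eq_abs, sq_abs, Real.sq_sqrt ha]

lemma inner_sqrt_smul_inv_sqrt_smul {a : ℝ} (ha : 0 < a) (v k : F) :
    inner ℝ (Real.sqrt a • v) ((Real.sqrt a)⁻¹ • k) = inner ℝ v k := by
  have : Real.sqrt a ≠ 0 := (Real.sqrt_pos.2 ha).ne'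
  rw [inner_smul_left, inner_smul_right, conj_trivial, ← mul_assoc, mul_inv_cancel₀ this, one_mul]

lemma memLp_two_sqrt_smul_iff {μ : Measure X} {σ : X → ℝ} {v : X → F}
    (hσ : AEStronglyMeasurable σ μ) (hσ0 : ∀ᵐ x ∂μ, 0 ≤ σ x) (hv : AEStronglyMeasurable v μ) :
    MemLp (fun x => Real.sqrt (σ x) • v x) 2 μ ↔
      ∫⁻ x, ENNReal.ofReal (σ x * ‖v x‖ ^ 2) ∂μ < ⊤ := by
  have hm : AEStronglyMeasurable (fun x => Real.sqrt (σ x)) μ :=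
    Real.continuous_sqrt.comp_aestronglyMeasurable hσ
  have hmv : AEStronglyMeasurable (fun x => Real.sqrt (σ x) • v x) μ := hm.smul hv
  rw [memLp_two_iff_integrable_sq_norm hmv]
  have he : (fun x => ‖Real.sqrt (σ x) • v x‖ ^ 2) =ᵐ[μ] fun x => σ x * ‖v x‖ ^ 2 := by
    filter_upwards [hσ0] with x hx using norm_sqrt_smul_sq hx _
  rw [integrable_congr he, Integrable, hasFiniteIntegral_iff_ofReal, and_iff_right]
  · exact hσ.mul (hv.norm.pow 2)
  · filter_upwards [hσ0] with x hx
    positivity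

/-- Continuity is asked only on the compact set because the weights are controlled only inside the
domain. -/
lemma memLp_two_of_continuousOn_isCompact {X F : Type*} [NormedAddCommGroup F] [TopologicalSpace X]
    [T2Space X] [MeasurableSpace X] [BorelSpace X] [SecondCountableTopology X] {μ : Measure X}
    [IsFiniteMeasureOnCompacts μ]
    {K s : Set X} (hK : IsCompact K) (hs : MeasurableSet s) {g : X → F} (hg : ContinuousOn g K)
    (h0 : ∀ x ∈ s, x ∉ K → g x = 0) : MemLp g 2 (μ.restrict s) := by
  have hKm := hK.measurableSet
  have h1 : MemLp g 2 (μ.restrict K) := by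
    rw [memLp_two_iff_integrable_sq_norm (hg.aestronglyMeasurable_of_isCompact hK hKm)]
    exact (hg.norm.pow 2).integrableOn_compact hK
  have h2 : MemLp (K.indicator g) 2 μ := (memLp_indicator_iff_restrict hKm).2 h1
  refine (memLp_congr_ae ?_).1 (h2.restrict s)
  filter_upwards [ae_restrict_mem hs] with x hx
  by_cases hxK : x ∈ K
  · simp [hxK]
  · simp [hxK, h0 x hx hxK]

lemma ae_eq_of_integral_norm_sub_sq_le_zero {F : Type*} [NormedAddCommGroup F]
    {μ : Measure X} {u v : X → F} (hu : MemLp u 2 μ) (hv : MemLp v 2 μ)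
    (h : ∫ x, ‖u x - v x‖ ^ 2 ∂μ ≤ 0) : u =ᵐ[μ] v := by
  have h1 : ∫ x, ‖u x - v x‖ ^ 2 ∂μ = 0 := le_antisymm h (integral_nonneg fun x => by positivity)
  have h2 := (integral_eq_zero_iff_of_nonneg (fun x => by positivity)
    ((memLp_two_iff_integrable_sq_norm (hu.sub hv).1).1 (hu.sub hv))).1 h1
  filter_upwards [h2] with x hx
  have : ‖u x - v x‖ ^ 2 = 0 := hx
  rw [← sub_eq_zero, ← norm_eq_zero]
  exact pow_eq_zero_iff two_ne_zero |>.1 this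

end WeightedL2

/-! ### Test fields and the convex sets they generate. -/

section TestFields

lemma div2_linear {ψ χ : ℝ × ℝ → EuclideanSpace ℝ (Fin 2)} (hψ : Differentiable ℝ ψ)
    (hχ : Differentiable ℝ χ) (a b : ℝ) (x : ℝ × ℝ) :
    div2 (a • ψ + b • χ) x = a * div2 ψ x + b * div2 χ x := by
  unfold div2
  rw [fderiv_add ((hψ x).const_smul a) ((hχ x).const_smul b), fderiv_const_smul (hψ x),
    fderiv_const_smul (hχ x)]
  simp
  ring

lemma continuous_pd {ψ : E3 → E3} (hψ : ContDiff ℝ ∞ ψ) (j i : Fin 3) : Continuous (pd j i ψ) := by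
  have h := hψ.continuous_fderiv (by simp)
  unfold pd
  fun_prop

lemma continuous_dstar {ψ : E3 → E3} (hψ : ContDiff ℝ ∞ ψ) : Continuous (dstar ψ) := by
  unfold dstar
  refine (PiLp.continuous_toLp 2 _).comp (continuous_pi fun i => ?_)
  have := continuous_pd hψ
  fin_cases i <;> simp <;> exact (this _ _).sub (this _ _)

lemma continuous_div2 {ξ : ℝ × ℝ → EuclideanSpace ℝ (Fin 2)} (hξ : ContDiff ℝ ∞ ξ) :
    Continuous (div2 ξ) := by
  have h := hξ.continuous_fderiv (by simp)
  unfold div2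
  fun_prop

lemma dstar_eq_zero {ψ : E3 → E3} {x : E3} (hx : x ∉ tsupport ψ) : dstar ψ x = 0 := by
  have h : fderiv ℝ ψ x = 0 := by
    have := support_fderiv_subset ℝ (f := ψ)
    by_contra hne
    exact hx (this hne)
  ext i
  fin_cases i <;> simp [dstar, pd, h]

lemma div2_eq_zero {ξ : ℝ × ℝ → EuclideanSpace ℝ (Fin 2)} {x : ℝ × ℝ} (hx : x ∉ tsupport ξ) :
    div2 ξ x = 0 := by
  have h : fderiv ℝ ξ x = 0 := by
    have := support_fderiv_subset ℝ (f := ξ)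
    by_contra hne
    exact hx (this hne)
  simp [div2, h]

variable {E F : Type*} [NormedAddCommGroup E] [NormedSpace ℝ E] [NormedAddCommGroup F]
  [NormedSpace ℝ F]

lemma IsTest.linear {U : Set E} {ψ χ : E → F} (hψ : IsTest U ψ) (hχ : IsTest U χ) (a b : ℝ) :
    IsTest U (a • ψ + b • χ) := by
  have h1 : tsupport (a • ψ + b • χ) ⊆ tsupport ψ ∪ tsupport χ := by
    refine (tsupport_add _ _).trans (Set.union_subset_union ?_ ?_)
    · exact closure_mono (Function.support_const_smul_subset a ψ)
    · exact closure_mono (Function.support_const_smul_subset b χ)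
  refine ⟨(hψ.1.const_smul a).add (hχ.1.const_smul b), ?_,
    h1.trans (Set.union_subset hψ.2.2 hχ.2.2)⟩
  exact (IsCompact.union hψ.2.1 hχ.2.1).of_isClosed_subset (isClosed_tsupport _) h1

/-- The test fields admissible in the definition of a weighted variation. -/
def admissible (U : Set E) (ρ : E → ℝ) : Set (E → F) :=
  {ψ | IsTest U ψ ∧ ∀ x ∈ U, ‖ψ x‖ ≤ ρ x}

lemma convex_admissible (U : Set E) (ρ : E → ℝ) : Convex ℝ (admissible (F := F) U ρ) := by
  rintro ψ ⟨h1, h2⟩ χ ⟨h3, h4⟩ a b ha hb hab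
  refine ⟨h1.linear h3 a b, fun x hx => ?_⟩
  calc ‖(a • ψ + b • χ) x‖ ≤ ‖a • ψ x‖ + ‖b • χ x‖ := norm_add_le _ _
    _ = a * ‖ψ x‖ + b * ‖χ x‖ := by
      rw [norm_smul, norm_smul, Real.norm_of_nonneg ha, Real.norm_of_nonneg hb]
    _ ≤ a * ρ x + b * ρ x := by
      have := h2 x hx
      have := h4 x hx
      gcongr
    _ = ρ x := by rw [← add_mul, hab, one_mul]

lemma zero_mem_admissible {U : Set E} {ρ : E → ℝ} (h : ∀ x ∈ U, 0 ≤ ρ x) :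
    (0 : E → F) ∈ admissible U ρ := by
  refine ⟨⟨contDiff_const, HasCompactSupport.zero, ?_⟩, fun x hx => by simpa using h x hx⟩
  simp [tsupport]

/-- The functions `ρ^{-1/2} d^*ψ` representing the functionals `v ↦ ⟨dv, ψ⟩` after rescaling. -/
def dualFields (Ω : Set E3) (ρ : E3 → ℝ) : Set (E3 → E3) :=
  (fun ψ x => (Real.sqrt (ρ x))⁻¹ • dstar ψ x) '' admissible Ω ρ

/-- The functions `(ρt / r)^{-1/2} div ξ` representing the functionals `w ↦ ∫ w div ξ` after
rescaling. -/
def dualFields2 (Ωt : Set (ℝ × ℝ)) (ρt : ℝ × ℝ → ℝ) : Set (ℝ × ℝ → ℝ) :=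
  (fun ξ p => (Real.sqrt (ρt p / p.1))⁻¹ • div2 ξ p) '' admissible (interior Ωt) ρt

lemma convex_dualFields2 (Ωt : Set (ℝ × ℝ)) (ρt : ℝ × ℝ → ℝ) : Convex ℝ (dualFields2 Ωt ρt) := by
  rintro _ ⟨ψ, hψ, rfl⟩ _ ⟨χ, hχ, rfl⟩ a b ha hb hab
  refine ⟨a • ψ + b • χ, convex_admissible _ ρt hψ hχ ha hb hab, ?_⟩
  funext x
  simp only [Pi.add_apply, Pi.smul_apply, div2_linear (hψ.1.1.differentiable (by simp))
    (hχ.1.1.differentiable (by simp)), smul_eq_mul]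
  ring

lemma memLp_of_mem_dualFields {Ω : Set E3} {ρ : E3 → ℝ} (hΩ : IsOpen Ω) (hρ : ContinuousOn ρ Ω)
    (hρ0 : ∀ x ∈ Ω, 0 < ρ x) : ∀ k ∈ dualFields Ω ρ, MemLp k 2 (volume.restrict Ω) := by
  rintro _ ⟨ψ, ⟨⟨h1, h2, h3⟩, -⟩, rfl⟩
  refine memLp_two_of_continuousOn_isCompact (K := tsupport ψ) h2 hΩ.measurableSet ?_ ?_
  · refine ContinuousOn.smul (ContinuousOn.inv₀ (hρ.mono h3).sqrt fun x hx => ?_)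
      (continuous_dstar h1).continuousOn
    exact (Real.sqrt_pos.2 (hρ0 x (h3 hx))).ne'
  · intro x _ hx
    simp [dstar_eq_zero hx]

lemma memLp_of_mem_dualFields2 {Ωt : Set (ℝ × ℝ)} {ρt : ℝ × ℝ → ℝ} (hm : MeasurableSet Ωt)
    (hpos : ∀ p ∈ interior Ωt, 0 < p.1) (hρ : ContinuousOn ρt Ωt)
    (hρ0 : ∀ x ∈ Ωt, 0 < ρt x) : ∀ k ∈ dualFields2 Ωt ρt, MemLp k 2 (volume.restrict Ωt) := by
  rintro _ ⟨ψ, ⟨⟨h1, h2, h3⟩, -⟩, rfl⟩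
  refine memLp_two_of_continuousOn_isCompact (K := tsupport ψ) h2 hm ?_ ?_
  · refine ContinuousOn.smul (ContinuousOn.inv₀ (ContinuousOn.sqrt (ContinuousOn.div
      (hρ.mono (h3.trans interior_subset)) continuous_fst.continuousOn
      fun p hp => (hpos p (h3 hp)).ne')) fun x hx => ?_) (continuous_div2 h1).continuousOn
    exact (Real.sqrt_pos.2 (div_pos (hρ0 x (interior_subset (h3 hx))) (hpos x (h3 hx)))).ne'
  · intro x _ hx
    simp [div2_eq_zero hx]

end TestFields

/-! ### From a certificate to the unique minimizer. -/

section Minimizers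

/-- Local integrability comes for free on the right-hand side, since ρ^{-1/2} is continuous on Ω. -/
lemma memL2rho_iff {Ω : Set E3} {ρ : E3 → ℝ} (hΩ : IsOpen Ω) (hρ : ContinuousOn ρ Ω)
    (hρ0 : ∀ x ∈ Ω, 0 < ρ x) {v : E3 → E3} :
    MemL2rho Ω ρ v ↔ MemLp (fun x => Real.sqrt (ρ x) • v x) 2 (volume.restrict Ω) := by
  have hm : AEStronglyMeasurable ρ (volume.restrict Ω) :=
    hρ.aestronglyMeasurable hΩ.measurableSet
  have h0 : ∀ᵐ x ∂volume.restrict Ω, 0 ≤ ρ x := by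
    filter_upwards [ae_restrict_mem hΩ.measurableSet] with x hx using (hρ0 x hx).le
  constructor
  · rintro ⟨h1, h2⟩
    exact (memLp_two_sqrt_smul_iff hm h0 h1.aestronglyMeasurable).2 h2
  · intro h
    have h1 : LocallyIntegrableOn (fun x => Real.sqrt (ρ x) • v x) Ω volume :=
      locallyIntegrableOn_of_locallyIntegrable_restrict (h.locallyIntegrable one_le_two)
    have h2 := h1.continuousOn_smul hΩ.isLocallyClosed (g := fun x => (Real.sqrt (ρ x))⁻¹)
      (hρ.sqrt.inv₀ fun x hx => (Real.sqrt_pos.2 (hρ0 x hx)).ne')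
    have h3 : LocallyIntegrableOn v Ω volume := by
      refine h2.congr ?_
      filter_upwards [ae_restrict_mem hΩ.measurableSet] with x hx
      exact inv_smul_smul₀ (Real.sqrt_pos.2 (hρ0 x hx)).ne' _
    exact ⟨h3, (memLp_two_sqrt_smul_iff hm h0 h3.aestronglyMeasurable).1 h⟩

lemma integral_le_toReal_weightedVar {Ω : Set E3} {ρ : E3 → ℝ} {v : E3 → E3}
    (h : weightedVar Ω ρ v ≠ ⊤) {ψ : E3 → E3} (hψ : ψ ∈ admissible Ω ρ) :
    ∫ x in Ω, inner ℝ (v x) (dstar ψ x) ≤ (weightedVar Ω ρ v).toReal :=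
  (ENNReal.ofReal_le_iff_le_toReal h).1 (le_iSup₂_of_le (f := fun (ψ : E3 → E3)
    (_ : IsTest Ω ψ ∧ ∀ x ∈ Ω, ‖ψ x‖ ≤ ρ x) =>
      ENNReal.ofReal (∫ x in Ω, inner ℝ (v x) (dstar ψ x))) ψ hψ le_rfl)

lemma integral_le_toReal_weightedVar2 {Ωt : Set (ℝ × ℝ)} {ρt w : ℝ × ℝ → ℝ}
    (h : weightedVar2 Ωt ρt w ≠ ⊤) {ξ : ℝ × ℝ → EuclideanSpace ℝ (Fin 2)}
    (hξ : ξ ∈ admissible (interior Ωt) ρt) :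
    ∫ p in Ωt, w p * div2 ξ p ≤ (weightedVar2 Ωt ρt w).toReal :=
  (ENNReal.ofReal_le_iff_le_toReal h).1 (le_iSup₂_of_le
    (f := fun (ξ : ℝ × ℝ → EuclideanSpace ℝ (Fin 2))
    (_ : IsTest (interior Ωt) ξ ∧ ∀ p ∈ interior Ωt, ‖ξ p‖ ≤ ρt p) =>
      ENNReal.ofReal (∫ p in Ωt, w p * div2 ξ p)) ξ hξ le_rfl)

/-- Completing the square; the last term does not depend on v, so it does not affect minimization.
-/
lemma integral_quadratic_eq {X F : Type*} [MeasurableSpace X] [NormedAddCommGroup F]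
    [InnerProductSpace ℝ F] {μ : Measure X} {σ : X → ℝ} {v f : X → F} (hσ : ∀ᵐ x ∂μ, 0 ≤ σ x)
    (hv : MemLp (fun x => Real.sqrt (σ x) • v x) 2 μ)
    (hf : MemLp (fun x => Real.sqrt (σ x) • f x) 2 μ) :
    ∫ x, σ x * (‖v x‖ ^ 2 / 2 - inner ℝ (v x) (f x)) ∂μ =
      (1 / 2) * ∫ x, ‖Real.sqrt (σ x) • v x - Real.sqrt (σ x) • f x‖ ^ 2 ∂μ -
        (1 / 2) * ∫ x, ‖Real.sqrt (σ x) • f x‖ ^ 2 ∂μ := by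
  have i1 : Integrable (fun x => ‖Real.sqrt (σ x) • v x - Real.sqrt (σ x) • f x‖ ^ 2) μ :=
    (memLp_two_iff_integrable_sq_norm (hv.sub hf).1).1 (hv.sub hf)
  have i2 := (memLp_two_iff_integrable_sq_norm hf.1).1 hf
  rw [← integral_const_mul, ← integral_const_mul, ← integral_sub (i1.const_mul _) (i2.const_mul _)]
  refine integral_congr_ae ?_
  filter_upwards [hσ] with x hx
  rw [← smul_sub, norm_sqrt_smul_sq hx, norm_sqrt_smul_sq hx, norm_sub_sq_real]
  ring

lemma energyG_eq_coe {Ω : Set E3} {ρ : E3 → ℝ} {Φ v : E3 → E3} (h : weightedVar Ω ρ v ≠ ⊤) :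
    energyG Ω ρ Φ v = (((∫ x in Ω, ρ x * (‖v x‖ ^ 2 / 2 - inner ℝ (v x) (Φ x))) +
      (1 / 2) * (weightedVar Ω ρ v).toReal : ℝ) : EReal) := by
  have h1 : (1 / 2 : ℝ≥0∞) * weightedVar Ω ρ v ≠ ⊤ := ENNReal.mul_ne_top (by simp) h
  have h2 : ((1 / 2 : ℝ≥0∞) * weightedVar Ω ρ v).toReal = 1 / 2 * (weightedVar Ω ρ v).toReal := by
    simp
  rw [energyG, EReal.coe_add, ← h2, EReal.coe_ennreal_toReal h1]

lemma energyG_eq_top {Ω : Set E3} {ρ : E3 → ℝ} {Φ v : E3 → E3} (h : weightedVar Ω ρ v = ⊤) :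
    energyG Ω ρ Φ v = ⊤ := by
  rw [energyG, h, ENNReal.mul_top (by simp)]
  exact EReal.coe_add_top _

/-- A dual certificate determines the unique minimizer of `𝒢`. -/
theorem isMinimizerG_of_isDualCertificate {Ω : Set E3} {ρ : E3 → ℝ} {Φ p v₀ : E3 → E3}
    (hΩ : IsOpen Ω) (hρ : ContinuousOn ρ Ω) (hρ0 : ∀ x ∈ Ω, 0 < ρ x) (hΦ : MemL2rho Ω ρ Φ)
    (hp : IsDualCertificate (volume.restrict Ω) (dualFields Ω ρ)
      (fun x => Real.sqrt (ρ x) • Φ x) p)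
    (hv₀ : ∀ᵐ x ∂volume.restrict Ω,
      Real.sqrt (ρ x) • v₀ x = Real.sqrt (ρ x) • Φ x - (1 / 2 : ℝ) • p x) :
    IsMinimizerG Ω ρ Φ v₀ ∧
      ∀ v : E3 → E3, IsMinimizerG Ω ρ Φ v → v =ᵐ[volume.restrict Ω] v₀ := by
  set μ := volume.restrict Ω
  have hmem : ∀ᵐ x ∂μ, x ∈ Ω := ae_restrict_mem hΩ.measurableSet
  have hF := (memL2rho_iff hΩ hρ hρ0).1 hΦ
  have hD := memLp_of_mem_dualFields hΩ hρ hρ0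
  have hV : MemLp (fun x => Real.sqrt (ρ x) • Φ x - (1 / 2 : ℝ) • p x) 2 μ :=
    hF.sub (hp.memLp.const_smul (1 / 2 : ℝ))
  have hV' : MemLp (fun x => Real.sqrt (ρ x) • v₀ x) 2 μ := (memLp_congr_ae hv₀).2 hV
  have hpair : ∀ (v ψ : E3 → E3), ∫ x in Ω, inner ℝ (v x) (dstar ψ x) =
      ∫ x, inner ℝ (Real.sqrt (ρ x) • v x) ((Real.sqrt (ρ x))⁻¹ • dstar ψ x) ∂μ := by
    intro v ψ
    refine integral_congr_ae ?_
    filter_upwards [hmem] with x hx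
    rw [inner_sqrt_smul_inv_sqrt_smul (hρ0 x hx)]
  set Q : ℝ := ∫ x, inner ℝ (Real.sqrt (ρ x) • Φ x - (1 / 2 : ℝ) • p x) (p x) ∂μ with hQ
  -- Only this inequality is needed: together with the growth estimate it bounds the energy of v₀
  -- from above.
  have hvar : weightedVar Ω ρ v₀ ≤ ENNReal.ofReal Q := by
    refine iSup₂_le fun ψ hψ => ENNReal.ofReal_le_ofReal ?_
    have := hp.inner_le _ ⟨ψ, hψ, rfl⟩
    rw [hpair]
    refine le_trans (le_of_eq (integral_congr_ae ?_)) this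
    filter_upwards [hv₀] with x hx
    rw [hx]
  have hQ0 : 0 ≤ Q := by
    have := hp.inner_le _ ⟨0, zero_mem_admissible fun x hx => (hρ0 x hx).le, rfl⟩
    refine le_trans (le_of_eq ?_) this
    have h0 : ∀ x, dstar 0 x = 0 := fun x => dstar_eq_zero (by simp [tsupport])
    simp [h0]
  have hvtop : weightedVar Ω ρ v₀ ≠ ⊤ := (hvar.trans_lt ENNReal.ofReal_lt_top).ne
  have hvQ : (weightedVar Ω ρ v₀).toReal ≤ Q := ENNReal.toReal_le_of_le_ofReal hQ0 hvar
  have hσ : ∀ᵐ x ∂μ, 0 ≤ ρ x := by filter_upwards [hmem] with x hx using (hρ0 x hx).le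
  -- Dropping the squared distance gives minimality; keeping it forces any other minimizer to be at
  -- distance zero.
  have key : ∀ u, MemL2rho Ω ρ u → weightedVar Ω ρ u ≠ ⊤ →
      (∫ x in Ω, ρ x * (‖v₀ x‖ ^ 2 / 2 - inner ℝ (v₀ x) (Φ x))) +
      (1 / 2) * (weightedVar Ω ρ v₀).toReal +
      (1 / 2) * ∫ x, ‖Real.sqrt (ρ x) • u x - Real.sqrt (ρ x) • v₀ x‖ ^ 2 ∂μ ≤
      (∫ x in Ω, ρ x * (‖u x‖ ^ 2 / 2 - inner ℝ (u x) (Φ x))) +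
      (1 / 2) * (weightedVar Ω ρ u).toReal := by
    intro u hu hut
    have hU := (memL2rho_iff hΩ hρ hρ0).1 hu
    have := hp.energy_add_sq_le hD hF hU (T := (weightedVar Ω ρ u).toReal) (by
      rintro _ ⟨ψ, hψ, rfl⟩
      rw [← hpair]
      exact integral_le_toReal_weightedVar hut hψ)
    rw [integral_quadratic_eq hσ hV' hF, integral_quadratic_eq hσ hU hF]
    have e1 : ∫ x, ‖Real.sqrt (ρ x) • v₀ x - Real.sqrt (ρ x) • Φ x‖ ^ 2 ∂μ =
        ∫ x, ‖(Real.sqrt (ρ x) • Φ x - (1 / 2 : ℝ) • p x) - Real.sqrt (ρ x) • Φ x‖ ^ 2 ∂μ := by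
      refine integral_congr_ae ?_
      filter_upwards [hv₀] with x hx
      rw [hx]
    have e2 : ∫ x, ‖Real.sqrt (ρ x) • u x - Real.sqrt (ρ x) • v₀ x‖ ^ 2 ∂μ =
        ∫ x, ‖Real.sqrt (ρ x) • u x - (Real.sqrt (ρ x) • Φ x - (1 / 2 : ℝ) • p x)‖ ^ 2 ∂μ := by
      refine integral_congr_ae ?_
      filter_upwards [hv₀] with x hx
      rw [hx]
    rw [e1, e2]
    linarith
  have hmem₀ : MemL2rho Ω ρ v₀ := (memL2rho_iff hΩ hρ hρ0).2 hV'
  refine ⟨⟨hmem₀, fun u hu => ?_⟩, fun v hv => ?_⟩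
  · by_cases hut : weightedVar Ω ρ u = ⊤
    · rw [energyG_eq_top hut]; exact le_top
    · rw [energyG_eq_coe hvtop, energyG_eq_coe hut, EReal.coe_le_coe_iff]
      refine le_trans ?_ (key u hu hut)
      have : 0 ≤ ∫ x, ‖Real.sqrt (ρ x) • u x - Real.sqrt (ρ x) • v₀ x‖ ^ 2 ∂μ :=
        integral_nonneg fun x => by positivity
      linarith
  · have hle := hv.2 v₀ hmem₀
    have hut : weightedVar Ω ρ v ≠ ⊤ := by
      intro hut
      rw [energyG_eq_top hut, energyG_eq_coe hvtop] at hle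
      exact EReal.coe_ne_top _ (top_le_iff.1 hle)
    rw [energyG_eq_coe hvtop, energyG_eq_coe hut, EReal.coe_le_coe_iff] at hle
    have h1 := ae_eq_of_integral_norm_sub_sq_le_zero ((memL2rho_iff hΩ hρ hρ0).1 hv.1) hV'
      (by have := key v hv.1 hut; linarith)
    filter_upwards [h1, hmem] with x hx hxΩ
    exact smul_right_injective _ (Real.sqrt_pos.2 (hρ0 x hxΩ)).ne' hx

/-- A dual certificate determines the unique minimizer of `𝒢^red`; the variation of the minimizer
is bounded by its pairing with the certificate. -/
theorem isMinimizerGred_of_isDualCertificate {Ωt : Set (ℝ × ℝ)} {ρt φ p w₀ : ℝ × ℝ → ℝ}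
    (hm : MeasurableSet Ωt) (hpos : ∀ q ∈ interior Ωt, 0 < q.1)
    (hρ : ContinuousOn ρt Ωt) (hρ0 : ∀ q ∈ Ωt, 0 < ρt q)
    (hr : ∀ᵐ q ∂volume.restrict Ωt, 0 < q.1)
    (hF : MemLp (fun q => Real.sqrt (ρt q / q.1) • φ q) 2 (volume.restrict Ωt))
    (hp : IsDualCertificate (volume.restrict Ωt) (dualFields2 Ωt ρt)
      (fun q => Real.sqrt (ρt q / q.1) • φ q) p)
    (hw₀ : ∀ᵐ q ∂volume.restrict Ωt, Real.sqrt (ρt q / q.1) • w₀ q =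
      Real.sqrt (ρt q / q.1) • φ q - (1 / 2 : ℝ) • p q) :
    IsMinimizerGred Ωt ρt φ w₀ ∧
      (∀ w : ℝ × ℝ → ℝ, IsMinimizerGred Ωt ρt φ w → w =ᵐ[volume.restrict Ωt] w₀) ∧
      0 ≤ ∫ q in Ωt, inner ℝ (Real.sqrt (ρt q / q.1) • φ q - (1 / 2 : ℝ) • p q) (p q) ∧
      weightedVar2 Ωt ρt w₀ ≤ ENNReal.ofReal (∫ q in Ωt,
        inner ℝ (Real.sqrt (ρt q / q.1) • φ q - (1 / 2 : ℝ) • p q) (p q)) := by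
  set μ := volume.restrict Ωt
  have hmem : ∀ᵐ q ∂μ, q ∈ Ωt := ae_restrict_mem hm
  have hσ : ∀ᵐ q ∂μ, 0 < ρt q / q.1 := by
    filter_upwards [hmem, hr] with q h1 h2 using div_pos (hρ0 q h1) h2
  have hσm : AEStronglyMeasurable (fun q => ρt q / q.1) μ :=
    ((hρ.aestronglyMeasurable hm).aemeasurable.div
      measurable_fst.aemeasurable).aestronglyMeasurable
  have hiff : ∀ w, MemL2red Ωt ρt w ↔ MemLp (fun q => Real.sqrt (ρt q / q.1) • w q) 2 μ := by
    intro w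
    have hs : ∀ x, ρt x / x.1 * w x ^ 2 = ρt x / x.1 * ‖w x‖ ^ 2 := by simp
    constructor
    · rintro ⟨h1, h2⟩
      rw [memLp_two_sqrt_smul_iff hσm (hσ.mono fun q hq => hq.le) h1]
      simpa only [hs] using h2
    · intro h
      have h1 : AEStronglyMeasurable w μ := by
        have h2 : AEStronglyMeasurable (fun q => (Real.sqrt (ρt q / q.1))⁻¹) μ :=
          (hσm.aemeasurable.sqrt.inv).aestronglyMeasurable
        refine (h2.smul h.1).congr ?_
        filter_upwards [hσ] with q hq
        exact inv_smul_smul₀ (Real.sqrt_pos.2 hq).ne' _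
      rw [memLp_two_sqrt_smul_iff hσm (hσ.mono fun q hq => hq.le) h1] at h
      refine ⟨h1, ?_⟩
      simpa only [hs] using h
  have hD := memLp_of_mem_dualFields2 hm hpos hρ hρ0
  have hV : MemLp (fun x => Real.sqrt (ρt x / x.1) • φ x - (1 / 2 : ℝ) • p x) 2 μ :=
    hF.sub (hp.memLp.const_smul (1 / 2 : ℝ))
  have hV' : MemLp (fun x => Real.sqrt (ρt x / x.1) • w₀ x) 2 μ := (memLp_congr_ae hw₀).2 hV
  have hpair : ∀ (w : ℝ × ℝ → ℝ) (ξ : ℝ × ℝ → EuclideanSpace ℝ (Fin 2)),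
      ∫ q in Ωt, w q * div2 ξ q = ∫ q, inner ℝ (Real.sqrt (ρt q / q.1) • w q)
        ((Real.sqrt (ρt q / q.1))⁻¹ • div2 ξ q) ∂μ := by
    intro w ξ
    refine integral_congr_ae ?_
    filter_upwards [hσ] with x hx
    rw [inner_sqrt_smul_inv_sqrt_smul hx]
    simp [mul_comm]
  set Q : ℝ := ∫ x, inner ℝ (Real.sqrt (ρt x / x.1) • φ x - (1 / 2 : ℝ) • p x) (p x) ∂μ with hQ
  have hvar : weightedVar2 Ωt ρt w₀ ≤ ENNReal.ofReal Q := by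
    refine iSup₂_le fun ψ hψ => ENNReal.ofReal_le_ofReal ?_
    have := hp.inner_le _ ⟨ψ, hψ, rfl⟩
    rw [hpair]
    refine le_trans (le_of_eq (integral_congr_ae ?_)) this
    filter_upwards [hw₀] with x hx
    rw [hx]
  have hQ0 : 0 ≤ Q := by
    have := hp.inner_le _ ⟨0, zero_mem_admissible fun x hx => (hρ0 x (interior_subset hx)).le, rfl⟩
    refine le_trans (le_of_eq ?_) this
    have h0 : ∀ x, div2 0 x = 0 := fun x => div2_eq_zero (by simp [tsupport])
    simp [h0]
  have hvtop : weightedVar2 Ωt ρt w₀ ≠ ⊤ := (hvar.trans_lt ENNReal.ofReal_lt_top).ne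
  have hvQ : (weightedVar2 Ωt ρt w₀).toReal ≤ Q := ENNReal.toReal_le_of_le_ofReal hQ0 hvar
  have hquad : ∀ w, MemL2red Ωt ρt w → ∫⁻ q in Ωt, ENNReal.ofReal (ρt q * ((w q - φ q) ^ 2 / q.1)) =
      ENNReal.ofReal
        (∫ q, ‖Real.sqrt (ρt q / q.1) • w q - Real.sqrt (ρt q / q.1) • φ q‖ ^ 2 ∂μ) := by
    intro w hw
    have hW : MemLp (fun q => Real.sqrt (ρt q / q.1) • w q - Real.sqrt (ρt q / q.1) • φ q) 2 μ :=
      ((hiff w).1 hw).sub hF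
    rw [ofReal_integral_eq_lintegral_ofReal ((memLp_two_iff_integrable_sq_norm hW.1).1 hW)
      (ae_of_all _ fun x => by positivity)]
    refine lintegral_congr_ae ?_
    filter_upwards [hσ] with q hq
    rw [← smul_sub, norm_sqrt_smul_sq hq.le, Real.norm_eq_abs, sq_abs]
    congr 1
    ring
  have hen : ∀ w, MemL2red Ωt ρt w → weightedVar2 Ωt ρt w ≠ ⊤ → energyGred Ωt ρt φ w =
      ENNReal.ofReal ((1 / 2) * ((weightedVar2 Ωt ρt w).toReal +
        ∫ q, ‖Real.sqrt (ρt q / q.1) • w q - Real.sqrt (ρt q / q.1) • φ q‖ ^ 2 ∂μ)) := by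
    intro w hw hwt
    rw [energyGred, hquad w hw, ENNReal.ofReal_mul (by norm_num),
      ENNReal.ofReal_add ENNReal.toReal_nonneg (integral_nonneg fun x => by positivity),
      ENNReal.ofReal_toReal hwt]
    congr 1
    rw [ENNReal.ofReal_div_of_pos two_pos]
    simp
  have htop : ∀ w, weightedVar2 Ωt ρt w = ⊤ → energyGred Ωt ρt φ w = ⊤ := by
    intro w hw
    rw [energyGred, hw, top_add, ENNReal.mul_top (by simp)]
  have key : ∀ u, MemL2red Ωt ρt u → weightedVar2 Ωt ρt u ≠ ⊤ →
      (weightedVar2 Ωt ρt w₀).toReal +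
        ∫ q, ‖Real.sqrt (ρt q / q.1) • w₀ q - Real.sqrt (ρt q / q.1) • φ q‖ ^ 2 ∂μ +
        ∫ q, ‖Real.sqrt (ρt q / q.1) • u q - Real.sqrt (ρt q / q.1) • w₀ q‖ ^ 2 ∂μ ≤
      (weightedVar2 Ωt ρt u).toReal +
        ∫ q, ‖Real.sqrt (ρt q / q.1) • u q - Real.sqrt (ρt q / q.1) • φ q‖ ^ 2 ∂μ := by
    intro u hu hut
    have := hp.energy_add_sq_le hD hF ((hiff u).1 hu) (T := (weightedVar2 Ωt ρt u).toReal) (by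
      rintro _ ⟨ψ, hψ, rfl⟩
      rw [← hpair]
      exact integral_le_toReal_weightedVar2 hut hψ)
    have e1 : ∫ q, ‖Real.sqrt (ρt q / q.1) • w₀ q - Real.sqrt (ρt q / q.1) • φ q‖ ^ 2 ∂μ =
        ∫ q, ‖(Real.sqrt (ρt q / q.1) • φ q - (1 / 2 : ℝ) • p q) -
          Real.sqrt (ρt q / q.1) • φ q‖ ^ 2 ∂μ := by
      refine integral_congr_ae ?_
      filter_upwards [hw₀] with x hx
      rw [hx]
    have e2 : ∫ q, ‖Real.sqrt (ρt q / q.1) • u q - Real.sqrt (ρt q / q.1) • w₀ q‖ ^ 2 ∂μ =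
        ∫ q, ‖Real.sqrt (ρt q / q.1) • u q -
          (Real.sqrt (ρt q / q.1) • φ q - (1 / 2 : ℝ) • p q)‖ ^ 2 ∂μ := by
      refine integral_congr_ae ?_
      filter_upwards [hw₀] with x hx
      rw [hx]
    rw [e1, e2]
    linarith
  have hmem₀ : MemL2red Ωt ρt w₀ := (hiff w₀).2 hV'
  refine ⟨⟨hmem₀, fun u hu => ?_⟩, fun w hw => ?_, hQ0, hvar⟩
  · by_cases hut : weightedVar2 Ωt ρt u = ⊤
    · rw [htop u hut]; exact le_top
    · rw [hen _ hmem₀ hvtop, hen _ hu hut]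
      refine ENNReal.ofReal_le_ofReal (mul_le_mul_of_nonneg_left ?_ (by norm_num))
      refine le_trans ?_ (key u hu hut)
      have : 0 ≤ ∫ q, ‖Real.sqrt (ρt q / q.1) • u q - Real.sqrt (ρt q / q.1) • w₀ q‖ ^ 2 ∂μ :=
        integral_nonneg fun x => by positivity
      linarith
  · have hle := hw.2 w₀ hmem₀
    have hut : weightedVar2 Ωt ρt w ≠ ⊤ := by
      intro hut
      rw [htop w hut, hen _ hmem₀ hvtop] at hle
      exact ENNReal.ofReal_ne_top (top_le_iff.1 hle)
    rw [hen _ hmem₀ hvtop, hen _ hw.1 hut, ENNReal.ofReal_le_ofReal_iff (by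
      have : 0 ≤ ∫ q, ‖Real.sqrt (ρt q / q.1) • w₀ q - Real.sqrt (ρt q / q.1) • φ q‖ ^ 2 ∂μ :=
        integral_nonneg fun x => by positivity
      positivity)] at hle
    have h1 := ae_eq_of_integral_norm_sub_sq_le_zero ((hiff w).1 hw.1) hV'
      (by have := key w hw.1 hut; linarith)
    filter_upwards [h1, hσ] with x hx hxσ
    exact smul_right_injective _ (Real.sqrt_pos.2 hxσ).ne' hx

end Minimizers

/-! ### Rotating planar test fields into spatial test forms. -/

section LiftTest

/-- The `2`-form on `ℝ³` obtained by rotating a field on the `(r, z)` plane: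
`ξ_z e_r - ξ_r e_z` in terms of coefficients. -/
def liftTest (ξ : ℝ × ℝ → EuclideanSpace ℝ (Fin 2)) (x : E3) : E3 :=
  !₂[ξ (meridian x) 1 * (meridian x).1⁻¹ * x 0, ξ (meridian x) 1 * (meridian x).1⁻¹ * x 1,
    -ξ (meridian x) 0]

lemma meridian_fst_sq (x : E3) : (meridian x).1 ^ 2 = x 0 ^ 2 + x 1 ^ 2 :=
  Real.sq_sqrt (by positivity)

lemma isCompact_preimage_meridian {K : Set (ℝ × ℝ)} (hK : IsCompact K) :
    IsCompact (meridian ⁻¹' K) := by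
  refine Metric.isCompact_of_isClosed_isBounded (hK.isClosed.preimage continuous_meridian) ?_
  obtain ⟨R, hR⟩ := hK.isBounded.exists_norm_le
  refine isBounded_iff_forall_norm_le.2 ⟨|R| + |R|, fun x hx => ?_⟩
  have h1 := hR _ hx
  have h2 : |(meridian x).1| ≤ |R| := (norm_fst_le _).trans (h1.trans (le_abs_self R))
  have h3 : |(meridian x).2| ≤ |R| := (norm_snd_le _).trans (h1.trans (le_abs_self R))
  have h4 := meridian_fst_sq x
  have h5 : (meridian x).2 = x 2 := rfl
  refine abs_le_of_sq_le_sq' ?_ (by positivity) |>.2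
  rw [EuclideanSpace.norm_sq_eq, Fin.sum_univ_three]
  simp only [Real.norm_eq_abs, sq_abs]
  rw [← h4, ← h5, ← sq_abs (meridian x).1, ← sq_abs (meridian x).2]
  have := abs_nonneg (meridian x).1
  have := abs_nonneg (meridian x).2
  nlinarith

lemma contDiffAt_meridian {x : E3} (hx : 0 < (meridian x).1) : ContDiffAt ℝ ∞ meridian x := by
  have h : x 0 ^ 2 + x 1 ^ 2 ≠ 0 := by
    rw [← meridian_fst_sq]; positivity
  unfold meridian
  exact ContDiffAt.prodMk (ContDiffAt.sqrt (by fun_prop) h) (by fun_prop)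

lemma fderiv_meridian {x : E3} (hx : 0 < (meridian x).1) (u : E3) :
    fderiv ℝ meridian x u = ((x 0 * u 0 + x 1 * u 1) / (meridian x).1, u 2) := by
  have h : x 0 ^ 2 + x 1 ^ 2 ≠ 0 := by
    rw [← meridian_fst_sq]; positivity
  have p : ∀ i : Fin 3, HasFDerivAt (fun y : E3 => y i) (EuclideanSpace.proj i : E3 →L[ℝ] ℝ) x :=
    fun i => (EuclideanSpace.proj i : E3 →L[ℝ] ℝ).hasFDerivAt
  have h1 := ((((p 0).pow 2).add ((p 1).pow 2)).sqrt h).prodMk (p 2)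
  have h2 : HasFDerivAt meridian _ x := h1
  rw [h2.fderiv]
  ext
  · have hne : Real.sqrt (x 0 ^ 2 + x 1 ^ 2) ≠ 0 := hx.ne'
    simp [meridian]
    field_simp
  · simp

lemma liftTest_eq_zero {ξ : ℝ × ℝ → EuclideanSpace ℝ (Fin 2)} {x : E3} (h : ξ (meridian x) = 0) :
    liftTest ξ x = 0 := by
  ext i
  fin_cases i <;> simp [liftTest, h]

lemma norm_liftTest {ξ : ℝ × ℝ → EuclideanSpace ℝ (Fin 2)} {x : E3} (hx : 0 < (meridian x).1) :
    ‖liftTest ξ x‖ = ‖ξ (meridian x)‖ := by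
  have h := meridian_fst_sq x
  rw [← sq_eq_sq₀ (norm_nonneg _) (norm_nonneg _), EuclideanSpace.norm_sq_eq,
    EuclideanSpace.norm_sq_eq, Fin.sum_univ_three, Fin.sum_univ_two]
  simp only [Real.norm_eq_abs, sq_abs, liftTest]
  simp
  set r := (meridian x).1
  field_simp
  linear_combination (-(ξ (meridian x) 1) ^ 2) * h

lemma contDiffAt_liftTest {ξ : ℝ × ℝ → EuclideanSpace ℝ (Fin 2)} (hξ : ContDiff ℝ ∞ ξ) {x : E3}
    (hx : 0 < (meridian x).1) : ContDiffAt ℝ ∞ (liftTest ξ) x := by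
  have hm := contDiffAt_meridian hx
  have hc : ContDiffAt ℝ ∞ (fun y => ξ (meridian y)) x := hξ.contDiffAt.comp x hm
  have h0 : ContDiffAt ℝ ∞ (fun y => ξ (meridian y) 0) x := contDiffAt_euclidean.1 hc 0
  have h1 : ContDiffAt ℝ ∞ (fun y => ξ (meridian y) 1) x := contDiffAt_euclidean.1 hc 1
  have hr : ContDiffAt ℝ ∞ (fun y => (meridian y).1⁻¹) x := (contDiffAt_fst.comp x hm).inv hx.ne'
  refine contDiffAt_euclidean.2 fun i => ?_
  fin_cases i
  · exact (h1.mul hr).mul (by fun_prop)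
  · exact (h1.mul hr).mul (by fun_prop)
  · exact h0.neg

/-- The formula is singular on the axis, but the support of ξ stays at r > 0, so the lift vanishes
near every axis point. -/
lemma isTest_liftTest {Ω : Set E3} {Ωt : Set (ℝ × ℝ)} (h : IsRevolution Ω Ωt)
    {ξ : ℝ × ℝ → EuclideanSpace ℝ (Fin 2)} (hξ : IsTest (interior Ωt) ξ) :
    IsTest Ω (liftTest ξ) := by
  have hC := isCompact_preimage_meridian hξ.2.1
  have hsub : tsupport (liftTest ξ) ⊆ meridian ⁻¹' tsupport ξ := by
    refine closure_minimal (fun x hx => ?_) hC.isClosed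
    by_contra hn
    exact hx (liftTest_eq_zero (image_eq_zero_of_notMem_tsupport hn))
  have hpos : ∀ x ∈ meridian ⁻¹' tsupport ξ, meridian x ∈ Ωt ∧ 0 < (meridian x).1 := by
    intro x hx
    have := hξ.2.2 hx
    rwa [h.interior_eq] at this
  refine ⟨contDiff_iff_contDiffAt.2 fun x => ?_, hC.of_isClosed_subset (isClosed_tsupport _) hsub,
    fun x hx => (h.mem_iff x).2 (hpos x (hsub hx)).1⟩
  by_cases hx : x ∈ tsupport (liftTest ξ)
  · exact contDiffAt_liftTest hξ.1 (hpos x (hsub hx)).2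
  · refine (contDiffAt_const (c := (0 : E3))).congr_of_eventuallyEq ?_
    exact notMem_tsupport_iff_eventuallyEq.1 hx

lemma liftTest_mem_admissible {Ω : Set E3} {Ωt : Set (ℝ × ℝ)} (h : IsRevolution Ω Ωt)
    {ρ : E3 → ℝ} {ρt : ℝ × ℝ → ℝ} (hρ : ∀ x ∈ Ω, ρ x = ρt (meridian x))
    (hρ0 : ∀ x ∈ Ω, 0 ≤ ρ x)
    {ξ : ℝ × ℝ → EuclideanSpace ℝ (Fin 2)} (hξ : ξ ∈ admissible (interior Ωt) ρt) :
    liftTest ξ ∈ admissible Ω ρ := by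
  refine ⟨isTest_liftTest h hξ.1, fun x hx => ?_⟩
  by_cases hm : meridian x ∈ interior Ωt
  · have hm' := hm
    rw [h.interior_eq] at hm'
    rw [norm_liftTest hm'.2, hρ x hx]
    exact hξ.2 _ hm
  · rw [liftTest_eq_zero (image_eq_zero_of_notMem_tsupport fun hn => hm (hξ.1.2.2 hn)), norm_zero]
    exact hρ0 x hx

lemma pd_eq_fderiv_apply {ψ : E3 → E3} {x : E3} (hψ : DifferentiableAt ℝ ψ x) (j i : Fin 3) :
    pd j i ψ x = fderiv ℝ (fun y => ψ y i) x (EuclideanSpace.single j 1) := by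
  have h : HasFDerivAt (fun y => ψ y i)
      ((EuclideanSpace.proj i : E3 →L[ℝ] ℝ).comp (fderiv ℝ ψ x)) x :=
    (EuclideanSpace.proj i : E3 →L[ℝ] ℝ).hasFDerivAt.comp x hψ.hasFDerivAt
  rw [h.fderiv]
  rfl

/-- For a e_r + b e_z with a, b depending on (r, z), the curl is (∂_z a - ∂_r b) e_θ. Here a = ξ_z
and b = -ξ_r give the flat divergence of ξ, and e_θ = r dθ. -/
lemma dstar_liftTest {ξ : ℝ × ℝ → EuclideanSpace ℝ (Fin 2)} (hξ : ContDiff ℝ ∞ ξ) {x : E3}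
    (hx : 0 < (meridian x).1) :
    dstar (liftTest ξ) x = ((meridian x).1 * div2 ξ (meridian x)) • dtheta x := by
  have hd : DifferentiableAt ℝ (liftTest ξ) x :=
    (contDiffAt_liftTest hξ hx).differentiableAt (by simp)
  have hm : HasFDerivAt meridian (fderiv ℝ meridian x) x :=
    ((contDiffAt_meridian hx).differentiableAt (by simp)).hasFDerivAt
  have hξd : HasFDerivAt ξ (fderiv ℝ ξ (meridian x)) (meridian x) :=
    (hξ.differentiable (by simp) _).hasFDerivAt
  have hc : ∀ i : Fin 2, HasFDerivAt (fun p => ξ p i)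
      ((EuclideanSpace.proj i : EuclideanSpace ℝ (Fin 2) →L[ℝ] ℝ).comp
        (fderiv ℝ ξ (meridian x))) (meridian x) :=
    fun i => (EuclideanSpace.proj i : EuclideanSpace ℝ (Fin 2) →L[ℝ] ℝ).hasFDerivAt.comp _ hξd
  have hfst : HasFDerivAt (Prod.fst : ℝ × ℝ → ℝ) (ContinuousLinearMap.fst ℝ ℝ ℝ) (meridian x) :=
    hasFDerivAt_fst
  have hinv : HasFDerivAt (fun p : ℝ × ℝ => p.1⁻¹) _ (meridian x) :=
    (hasDerivAt_inv hx.ne').comp_hasFDerivAt (meridian x) hfst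
  have hg := ((hc 1).mul hinv).comp x hm
  have p : ∀ i : Fin 3, HasFDerivAt (fun y : E3 => y i) (EuclideanSpace.proj i : E3 →L[ℝ] ℝ) x :=
    fun i => (EuclideanSpace.proj i : E3 →L[ℝ] ℝ).hasFDerivAt
  have d0 : HasFDerivAt (fun y => liftTest ξ y 0) _ x := hg.mul (p 0)
  have d1 : HasFDerivAt (fun y => liftTest ξ y 1) _ x := hg.mul (p 1)
  have d2 : HasFDerivAt (fun y => liftTest ξ y 2) _ x := ((hc 0).comp x hm).neg
  have hsplit : ∀ a b : ℝ, fderiv ℝ ξ (meridian x) (a, b) =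
      a • fderiv ℝ ξ (meridian x) (1, 0) + b • fderiv ℝ ξ (meridian x) (0, 1) := by
    intro a b
    rw [← map_smul, ← map_smul, ← map_add]
    simp
  have hsq := meridian_fst_sq x
  have hne : x 0 ^ 2 + x 1 ^ 2 ≠ 0 := by rw [← hsq]; positivity
  have hr := hx.ne'
  ext i
  fin_cases i
  · simp [dstar, pd_eq_fderiv_apply hd, d1.fderiv, d2.fderiv, dtheta, fderiv_meridian hx, div2]
    rw [hsplit (x 1 / _) 0, ← hsq]
    simp
    field_simp
    ring
  · simp [dstar, pd_eq_fderiv_apply hd, d0.fderiv, d2.fderiv, dtheta, fderiv_meridian hx, div2]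
    rw [hsplit (x 0 / _) 0, ← hsq]
    simp
    field_simp
    ring
  · simp [dstar, pd_eq_fderiv_apply hd, d0.fderiv, d1.fderiv, dtheta, fderiv_meridian hx]
    rw [hsplit (x 0 / _) 0, hsplit (x 1 / _) 0]
    simp
    field_simp
    ring

end LiftTest

/-! ### Removing the condition that test fields vanish near the axis. -/

section Cutoff

lemma exists_bound_deriv_smoothTransition : ∃ C : ℝ, 0 ≤ C ∧
    ∀ t, |deriv Real.smoothTransition t| ≤ C := by
  have hc : Continuous (deriv Real.smoothTransition) :=
    (Real.smoothTransition.contDiff (n := 1)).continuous_deriv le_rfl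
  have hs : HasCompactSupport (deriv Real.smoothTransition) := by
    refine HasCompactSupport.intro (isCompact_Icc (a := (0 : ℝ)) (b := 1)) fun t ht => ?_
    rcases lt_or_ge t 0 with h | h
    · have : Real.smoothTransition =ᶠ[nhds t] fun _ => 0 := by
        filter_upwards [Iio_mem_nhds h] with s hs
        exact Real.smoothTransition.zero_of_nonpos (le_of_lt hs)
      rw [this.deriv_eq]; simp
    · have h1 : 1 < t := by
        by_contra h1
        exact ht ⟨h, not_lt.1 h1⟩
      have : Real.smoothTransition =ᶠ[nhds t] fun _ => 1 := by
        filter_upwards [Ioi_mem_nhds h1] with s hs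
        exact Real.smoothTransition.one_of_one_le (le_of_lt hs)
      rw [this.deriv_eq]; simp
  obtain ⟨C, hC⟩ := hs.exists_bound_of_continuous hc
  exact ⟨C, (norm_nonneg _).trans (hC 0), hC⟩

/-- A smooth cutoff in `r`, vanishing for `r ≤ ε` and equal to `1` for `r ≥ 2ε`. -/
def radialCutoff (ε : ℝ) (p : ℝ × ℝ) : ℝ := Real.smoothTransition (p.1 / ε - 1)

lemma contDiff_radialCutoff (ε : ℝ) : ContDiff ℝ ∞ (radialCutoff ε) :=
  Real.smoothTransition.contDiff.comp (by fun_prop)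

lemma radialCutoff_eq_zero {ε : ℝ} (hε : 0 < ε) {p : ℝ × ℝ} (hp : p.1 ≤ ε) :
    radialCutoff ε p = 0 :=
  Real.smoothTransition.zero_of_nonpos (by rw [sub_nonpos, div_le_one hε]; exact hp)

lemma abs_radialCutoff_le (ε : ℝ) (p : ℝ × ℝ) : |radialCutoff ε p| ≤ 1 := by
  rw [radialCutoff, abs_of_nonneg (Real.smoothTransition.nonneg _)]
  exact Real.smoothTransition.le_one _

lemma div2_radialCutoff_smul (ε : ℝ) {ξ : ℝ × ℝ → EuclideanSpace ℝ (Fin 2)}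
    (hξ : Differentiable ℝ ξ) (p : ℝ × ℝ) :
    div2 (fun q => radialCutoff ε q • ξ q) p = radialCutoff ε p * div2 ξ p +
      deriv Real.smoothTransition (p.1 / ε - 1) / ε * ξ p 0 := by
  have hfst : HasFDerivAt (fun q : ℝ × ℝ => q.1 / ε - 1)
      (ε⁻¹ • ContinuousLinearMap.fst ℝ ℝ ℝ) p := by
    have := ((hasFDerivAt_fst (𝕜 := ℝ) (E := ℝ) (F := ℝ) (p := p)).const_smul ε⁻¹).sub_const 1
    refine this.congr_of_eventuallyEq (Filter.Eventually.of_forall fun q => ?_)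
    simp [div_eq_inv_mul]
  have ht : HasDerivAt Real.smoothTransition (deriv Real.smoothTransition (p.1 / ε - 1))
      (p.1 / ε - 1) :=
    ((Real.smoothTransition.contDiff (n := 1)).differentiable (by simp) _).hasDerivAt
  have hη : HasFDerivAt (radialCutoff ε) _ p := ht.comp_hasFDerivAt p hfst
  have hd := hη.smul (hξ p).hasFDerivAt
  have hd' : HasFDerivAt (fun q => radialCutoff ε q • ξ q) _ p := hd
  unfold div2
  rw [hd'.fderiv]
  simp
  ring

lemma div2_radialCutoff_smul_of_lt {ε : ℝ} (hε : 0 < ε) {ξ : ℝ × ℝ → EuclideanSpace ℝ (Fin 2)}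
    {p : ℝ × ℝ} (hp : 2 * ε < p.1) :
    div2 (fun q => radialCutoff ε q • ξ q) p = div2 ξ p := by
  have : (fun q => radialCutoff ε q • ξ q) =ᶠ[nhds p] ξ := by
    filter_upwards [(isOpen_lt continuous_const continuous_fst).mem_nhds hp] with q hq
    have hq' : 2 * ε < q.1 := hq
    rw [radialCutoff, Real.smoothTransition.one_of_one_le, one_smul]
    rw [le_sub_iff_add_le, le_div_iff₀ hε]
    linarith
  unfold div2
  rw [this.fderiv_eq]

/-- The factor 1/r only helps: |w| ≤ w²/r + r for r > 0, and both terms are integrable on the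
compact set. -/
lemma integrableOn_mul_of_support_subset {s K : Set (ℝ × ℝ)}
    (hK : IsCompact K) {w f : ℝ × ℝ → ℝ} (hr : ∀ᵐ p ∂volume.restrict s, 0 < p.1)
    (hw : AEStronglyMeasurable w (volume.restrict s))
    (hwK : IntegrableOn (K.indicator fun p => w p ^ 2 / p.1) s)
    (hf : Continuous f) (hfK : ∀ p ∉ K, f p = 0) :
    IntegrableOn (fun p => w p * f p) s := by
  obtain ⟨M, hM⟩ := (HasCompactSupport.intro hK hfK).exists_bound_of_continuous hf
  have hr1 : Integrable (K.indicator fun p : ℝ × ℝ => p.1) (volume.restrict s) := by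
    have : IntegrableOn (fun p : ℝ × ℝ => p.1) K volume :=
      continuous_fst.continuousOn.integrableOn_compact hK
    exact ((integrable_indicator_iff hK.measurableSet).2 this).restrict
  refine Integrable.mono' ((hwK.add hr1).const_mul M) (hw.mul hf.aestronglyMeasurable) ?_
  filter_upwards [hr] with p hp
  by_cases hpK : p ∈ K
  · simp only [Pi.add_apply, Set.indicator_of_mem hpK, norm_mul]
    have h1 := hM p
    have h2 : ‖w p‖ ≤ w p ^ 2 / p.1 + p.1 := by
      rw [Real.norm_eq_abs, div_add' _ _ _ hp.ne', le_div_iff₀ hp, ← sq_abs]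
      nlinarith [sq_nonneg (|w p| - p.1), abs_nonneg (w p), mul_nonneg (abs_nonneg (w p)) hp.le]
    rw [mul_comm]
    have h0 := norm_nonneg (w p)
    exact mul_le_mul h1 h2 h0 ((norm_nonneg _).trans h1)
  · simp [hpK, hfK p hpK]

/-- Fields whose support reaches the axis may be used to test the weighted variation on the
`(r, z)` plane, since `∫ w² / r` is finite. -/
theorem integral_mul_div2_le_toReal_weightedVar2 {Ωt K : Set (ℝ × ℝ)} {ρt w : ℝ × ℝ → ℝ}
    {ξ : ℝ × ℝ → EuclideanSpace ℝ (Fin 2)}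
    (hr : ∀ᵐ p ∂volume.restrict Ωt, 0 < p.1) (hK : IsCompact K)
    (hKΩ : ∀ p ∈ K, 0 < p.1 → p ∈ interior Ωt) (hξ : ContDiff ℝ ∞ ξ) (hξK : ∀ p ∉ K, ξ p = 0)
    (hξρ : ∀ p ∈ interior Ωt, ‖ξ p‖ ≤ ρt p)
    (hw : AEStronglyMeasurable w (volume.restrict Ωt))
    (hwK : IntegrableOn (K.indicator fun p => w p ^ 2 / p.1) Ωt)
    (hS : weightedVar2 Ωt ρt w ≠ ⊤) :
    ∫ p in Ωt, w p * div2 ξ p ≤ (weightedVar2 Ωt ρt w).toReal := by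
  set μ := volume.restrict Ωt
  have htK : tsupport ξ ⊆ K := closure_minimal (fun p hp => by
    by_contra hn
    exact hp (hξK p hn)) hK.isClosed
  have hcut : ∀ ε : ℝ, 0 < ε → ∀ p ∉ K, div2 (fun q => radialCutoff ε q • ξ q) p = 0 := by
    intro ε hε p hp
    refine div2_eq_zero fun hn => hp ?_
    exact htK (tsupport_smul_subset_right (radialCutoff ε) ξ hn)
  have hcd : ∀ ε, ContDiff ℝ ∞ (fun q => radialCutoff ε q • ξ q) :=
    fun ε => (contDiff_radialCutoff ε).smul hξ
  have hadm : ∀ ε : ℝ, 0 < ε →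
      (fun q => radialCutoff ε q • ξ q) ∈ admissible (interior Ωt) ρt := by
    intro ε hε
    have hsub : tsupport (fun q => radialCutoff ε q • ξ q) ⊆ K ∩ {p | ε ≤ p.1} := by
      refine closure_minimal (fun p hp => ⟨?_, ?_⟩)
        (hK.isClosed.inter (isClosed_le continuous_const continuous_fst))
      · by_contra hn
        exact hp (by simp [hξK p hn])
      · by_contra hn
        exact hp (by simp [radialCutoff_eq_zero hε (le_of_lt (not_le.1 hn))])
    refine ⟨⟨hcd ε, hK.of_isClosed_subset (isClosed_tsupport _)
      (hsub.trans Set.inter_subset_left), fun p hp => ?_⟩, fun p hp => ?_⟩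
    · exact hKΩ p (hsub hp).1 (hε.trans_le (hsub hp).2)
    · rw [norm_smul]
      refine le_trans ?_ (hξρ p hp)
      exact mul_le_of_le_one_left (norm_nonneg _) (abs_radialCutoff_le ε p)
  obtain ⟨C, hC0, hC⟩ := exists_bound_deriv_smoothTransition
  obtain ⟨M₁, hM₁⟩ := (HasCompactSupport.intro hK fun p hp => div2_eq_zero fun hn =>
    hp (htK hn)).exists_bound_of_continuous (continuous_div2 hξ)
  obtain ⟨M₂, hM₂⟩ := (HasCompactSupport.intro hK hξK).exists_bound_of_continuous hξ.continuous
  have hM₁0 : 0 ≤ M₁ := (norm_nonneg _).trans (hM₁ 0)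
  have hM₂0 : 0 ≤ M₂ := (norm_nonneg _).trans (hM₂ 0)
  set B := M₁ + C * M₂ with hB
  have hB0 : 0 ≤ B := by positivity
  obtain ⟨Z, hZ⟩ := hK.isBounded.exists_norm_le
  set g : ℝ × ℝ → ℝ := K.indicator fun p => w p ^ 2 / p.1 with hg
  -- The divergences differ only for r ≤ 2ε. The derivative of the cutoff contributes C M₂ / ε, and
  -- ε ≤ 1 lets M₁ be absorbed in the same form.
  have hdiff : ∀ ε : ℝ, 0 < ε → ε ≤ 1 → ∀ p : ℝ × ℝ, 0 < p.1 →
      |div2 ξ p - div2 (fun q => radialCutoff ε q • ξ q) p| ≤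
        (K ∩ {p | p.1 ≤ 2 * ε}).indicator (fun _ => B / ε) p := by
    intro ε hε hε1 p hp
    by_cases hpK : p ∈ K
    · by_cases hp2 : p.1 ≤ 2 * ε
      · rw [Set.indicator_of_mem (show p ∈ K ∩ {p : ℝ × ℝ | p.1 ≤ 2 * ε} from ⟨hpK, hp2⟩),
          div2_radialCutoff_smul ε (hξ.differentiable (by simp))]
        have e : div2 ξ p - (radialCutoff ε p * div2 ξ p +
            deriv Real.smoothTransition (p.1 / ε - 1) / ε * ξ p 0) =
            (1 - radialCutoff ε p) * div2 ξ p -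
              deriv Real.smoothTransition (p.1 / ε - 1) / ε * ξ p 0 := by ring
        rw [e]
        have a1 : |(1 - radialCutoff ε p) * div2 ξ p| ≤ M₁ := by
          rw [abs_mul]
          refine le_trans (mul_le_of_le_one_left (abs_nonneg _) ?_) (hM₁ p)
          have u1 : 0 ≤ radialCutoff ε p := Real.smoothTransition.nonneg _
          have u2 : radialCutoff ε p ≤ 1 := Real.smoothTransition.le_one _
          rw [abs_le]; constructor <;> linarith
        have a2 : |deriv Real.smoothTransition (p.1 / ε - 1) / ε * ξ p 0| ≤ C / ε * M₂ := by
          rw [abs_mul, abs_div, abs_of_pos hε]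
          have := hC (p.1 / ε - 1)
          have h3 : |ξ p 0| ≤ M₂ := (PiLp.norm_apply_le (ξ p) 0).trans (hM₂ p)
          gcongr
        have a3 : M₁ ≤ M₁ / ε := by
          rw [le_div_iff₀ hε]
          exact mul_le_of_le_one_right hM₁0 hε1
        calc _ ≤ _ := abs_sub _ _
          _ ≤ M₁ / ε + C / ε * M₂ := by linarith
          _ = B / ε := by rw [hB]; ring
      · rw [div2_radialCutoff_smul_of_lt hε (not_le.1 hp2), sub_self, abs_zero]
        exact Set.indicator_nonneg (fun _ _ => by positivity) p
    · rw [hcut ε hε p hpK, div2_eq_zero fun hn => hpK (htK hn), sub_self, abs_zero]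
      exact Set.indicator_nonneg (fun _ _ => by positivity) p
  have hA : IntegrableOn (fun p => w p * div2 ξ p) Ωt :=
    integrableOn_mul_of_support_subset hK hr hw hwK (continuous_div2 hξ)
      fun p hp => div2_eq_zero fun hn => hp (htK hn)
  -- Young's inequality with parameter δ splits the error. The first part is an integral of w²/r
  -- over a layer shrinking to the axis; the second is of order δ uniformly in ε.
  have hmain : ∀ δ : ℝ, 0 < δ → ∀ ε : ℝ, 0 < ε → ε ≤ 1 →
      ∫ p in Ωt, w p * div2 ξ p ≤ (weightedVar2 Ωt ρt w).toReal +
        (B / (2 * δ) * ∫ p, {p | p.1 ≤ 2 * ε}.indicator g p ∂μ + B * δ * (4 * |Z|)) := by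
    intro δ hδ ε hε hε1
    have hAε : IntegrableOn (fun p => w p * div2 (fun q => radialCutoff ε q • ξ q) p) Ωt :=
      integrableOn_mul_of_support_subset hK hr hw hwK (continuous_div2 (hcd ε)) (hcut ε hε)
    have h1 := integral_le_toReal_weightedVar2 hS (hadm ε hε)
    -- A box containing the part of K in the layer 0 < r ≤ 2ε; its area 4ε|Z| compensates the factor
    -- 1/ε.
    set R : Set (ℝ × ℝ) := Set.Ioc 0 (2 * ε) ×ˢ Set.Icc (-|Z|) |Z| with hR
    have hRm : MeasurableSet R := measurableSet_Ioc.prod measurableSet_Icc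
    have hRv : volume R = ENNReal.ofReal (2 * ε) * ENNReal.ofReal (2 * |Z|) := by
      rw [hR, Measure.volume_eq_prod, Measure.prod_prod, Real.volume_Ioc, Real.volume_Icc]
      ring_nf
    have hRfin : volume R ≠ ⊤ := by
      rw [hRv]; exact ENNReal.mul_ne_top ENNReal.ofReal_ne_top ENNReal.ofReal_ne_top
    have hRi : Integrable (R.indicator fun _ => (1 : ℝ)) (volume : Measure (ℝ × ℝ)) :=
      (integrable_indicator_iff hRm).2 (integrableOn_const hRfin)
    have hgi : Integrable ({p | p.1 ≤ 2 * ε}.indicator g) μ :=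
      Integrable.indicator hwK (measurableSet_le measurable_fst measurable_const)
    have hRle : ∫ p, R.indicator (fun _ => (1 : ℝ)) p ∂μ ≤ 2 * ε * (2 * |Z|) := by
      have : ∫ p, R.indicator (fun _ => (1 : ℝ)) p ∂μ ≤ ∫ p, R.indicator (fun _ => (1 : ℝ)) p :=
        integral_mono_measure Measure.restrict_le_self
          (ae_of_all _ fun p => Set.indicator_nonneg (fun _ _ => zero_le_one) p) hRi
      refine this.trans (le_of_eq ?_)
      rw [integral_indicator hRm]
      simp only [integral_const, MeasurableSet.univ, measureReal_restrict_apply, Set.univ_inter,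
        smul_eq_mul, mul_one]
      rw [measureReal_def, hRv, ENNReal.toReal_mul, ENNReal.toReal_ofReal (by positivity),
        ENNReal.toReal_ofReal (by positivity)]
    have h2 : ∫ p in Ωt, w p * div2 ξ p -
        w p * div2 (fun q => radialCutoff ε q • ξ q) p ≤
        ∫ p, B / (2 * δ) * {p | p.1 ≤ 2 * ε}.indicator g p +
          B * δ / ε * R.indicator (fun _ => (1 : ℝ)) p ∂μ := by
      refine integral_mono_ae (hA.sub hAε) ((hgi.const_mul _).add (hRi.restrict.const_mul _)) ?_
      filter_upwards [hr] with p hp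
      have h3 := hdiff ε hε hε1 p hp
      simp only [← mul_sub]
      refine (le_abs_self _).trans ?_
      rw [abs_mul]
      refine (mul_le_mul_of_nonneg_left h3 (abs_nonneg _)).trans ?_
      by_cases hpK : p ∈ K
      · by_cases hp2 : p.1 ≤ 2 * ε
        · have hpR : p ∈ R := by
            refine ⟨⟨hp, hp2⟩, abs_le.1 ?_⟩
            exact (norm_snd_le p).trans ((hZ p hpK).trans (le_abs_self Z))
          rw [Set.indicator_of_mem (show p ∈ K ∩ {p : ℝ × ℝ | p.1 ≤ 2 * ε} from ⟨hpK, hp2⟩),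
            Set.indicator_of_mem hpR,
            Set.indicator_of_mem (show p ∈ {p : ℝ × ℝ | p.1 ≤ 2 * ε} from hp2), hg,
            Set.indicator_of_mem hpK]
          have h4 : |w p| / ε ≤ 1 / (2 * δ) * (w p ^ 2 / p.1) + δ / ε := by
            have h5 : |w p| / ε ≤ 1 / (2 * δ) * (|w p| ^ 2 / p.1) + δ * p.1 / (2 * ε ^ 2) := by
              have : 1 / (2 * δ) * (|w p| ^ 2 / p.1) + δ * p.1 / (2 * ε ^ 2) - |w p| / ε =
                  (|w p| * ε - δ * p.1) ^ 2 / (2 * δ * p.1 * ε ^ 2) := by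
                field_simp
                ring
              have h6 : 0 ≤ (|w p| * ε - δ * p.1) ^ 2 / (2 * δ * p.1 * ε ^ 2) := by positivity
              linarith
            have h7 : δ * p.1 / (2 * ε ^ 2) ≤ δ / ε := by
              rw [div_le_div_iff₀ (by positivity) hε]
              nlinarith [mul_le_mul_of_nonneg_left hp2 (mul_pos hδ hε).le]
            rw [sq_abs] at h5
            linarith
          calc |w p| * (B / ε) = B * (|w p| / ε) := by ring
            _ ≤ B * (1 / (2 * δ) * (w p ^ 2 / p.1) + δ / ε) := by gcongr
            _ = _ := by ring
        · rw [Set.indicator_of_notMem fun h => hp2 h.2, mul_zero]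
          refine add_nonneg (mul_nonneg (by positivity) ?_) (mul_nonneg (by positivity) ?_)
          · rw [Set.indicator_of_notMem (show p ∉ {p : ℝ × ℝ | p.1 ≤ 2 * ε} from hp2)]
          · exact Set.indicator_nonneg (fun _ _ => zero_le_one) p
      · rw [Set.indicator_of_notMem fun h => hpK h.1, mul_zero]
        refine add_nonneg (mul_nonneg (by positivity) ?_) (mul_nonneg (by positivity) ?_)
        · simp [Set.indicator, hg, hpK]
        · exact Set.indicator_nonneg (fun _ _ => zero_le_one) p
    rw [integral_sub hA hAε, integral_add (hgi.const_mul _) (hRi.restrict.const_mul _),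
      integral_const_mul, integral_const_mul] at h2
    have h8 : B * δ / ε * ∫ p, R.indicator (fun _ => (1 : ℝ)) p ∂μ ≤ B * δ * (4 * |Z|) := by
      refine (mul_le_mul_of_nonneg_left hRle (by positivity)).trans (le_of_eq ?_)
      field_simp
      ring
    linarith
  have hlim : Filter.Tendsto (fun n : ℕ =>
      ∫ p, {p : ℝ × ℝ | p.1 ≤ 2 * (1 / ((n : ℝ) + 1))}.indicator g p ∂μ) Filter.atTop (nhds 0) := by
    have : (0 : ℝ) = ∫ p, (0 : ℝ) ∂μ := by simp
    rw [this]
    refine tendsto_integral_of_dominated_convergence (fun p => ‖g p‖) (fun n => ?_) hwK.norm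
      (fun n => ae_of_all _ fun p => norm_indicator_le_norm_self g p) ?_
    · exact hwK.1.indicator (measurableSet_le measurable_fst measurable_const)
    · filter_upwards [hr] with p hp
      refine tendsto_const_nhds.congr' ?_
      have h1 : Filter.Tendsto (fun n : ℕ => 2 * (1 / ((n : ℝ) + 1))) Filter.atTop (nhds 0) := by
        simpa using tendsto_one_div_add_atTop_nhds_zero_nat.const_mul (2 : ℝ)
      filter_upwards [h1.eventually_lt_const hp] with n hn
      rw [Set.indicator_of_notMem]
      exact not_le.2 hn
  -- First ε → 0 with δ fixed, by dominated convergence; afterwards δ → 0.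
  have hδ : ∀ δ : ℝ, 0 < δ →
      ∫ p in Ωt, w p * div2 ξ p ≤ (weightedVar2 Ωt ρt w).toReal + B * δ * (4 * |Z|) := by
    intro δ hδ
    have h1 := ((hlim.const_mul (B / (2 * δ))).add_const (B * δ * (4 * |Z|))).const_add
      (weightedVar2 Ωt ρt w).toReal
    rw [mul_zero, zero_add] at h1
    refine ge_of_tendsto' h1 fun n => ?_
    refine hmain δ hδ _ (by positivity) ?_
    rw [div_le_one (by positivity)]
    linarith [n.cast_nonneg (α := ℝ)]
  have h1 : Filter.Tendsto (fun δ : ℝ => (weightedVar2 Ωt ρt w).toReal + B * δ * (4 * |Z|))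
      (nhdsWithin 0 (Set.Ioi 0)) (nhds ((weightedVar2 Ωt ρt w).toReal + B * 0 * (4 * |Z|))) := by
    refine Filter.Tendsto.mono_left ?_ nhdsWithin_le_nhds
    exact Continuous.tendsto (by fun_prop) 0
  rw [mul_zero, zero_mul, add_zero] at h1
  refine ge_of_tendsto h1 ?_
  filter_upwards [self_mem_nhdsWithin] with δ hδ' using hδ δ hδ'

end Cutoff

/-! ### Slicing spatial test forms by meridian half-planes. -/

section Slices

/-- The trace of a `2`-form on a meridian half-plane, as a field in the `(r, z)` plane:
`(-ψ_z, ψ_r)` in terms of cylindrical components. -/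
def sliceTest (ψ : E3 → E3) (α : ℝ) (p : ℝ × ℝ) : EuclideanSpace ℝ (Fin 2) :=
  !₂[-ψ (cylMap (p, α)) 2,
    Real.cos α * ψ (cylMap (p, α)) 0 + Real.sin α * ψ (cylMap (p, α)) 1]

/-- The parametrization of a meridian plane as a linear map. -/
def meridianPlane (α : ℝ) : ℝ × ℝ →L[ℝ] E3 :=
  (ContinuousLinearMap.fst ℝ ℝ ℝ).smulRight (!₂[Real.cos α, Real.sin α, 0] : E3) +
    (ContinuousLinearMap.snd ℝ ℝ ℝ).smulRight (EuclideanSpace.single 2 1 : E3)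

lemma cylMap_eq_meridianPlane (p : ℝ × ℝ) (α : ℝ) : cylMap (p, α) = meridianPlane α p := by
  ext i
  fin_cases i <;> simp [cylMap, cyl, meridianPlane]

lemma norm_sq_cylMap (p : ℝ × ℝ) (α : ℝ) : ‖cylMap (p, α)‖ ^ 2 = p.1 ^ 2 + p.2 ^ 2 := by
  rw [EuclideanSpace.norm_sq_eq, Fin.sum_univ_three]
  simp only [Real.norm_eq_abs, sq_abs, cylMap, cyl_zero, cyl_one, cyl_two]
  linear_combination p.1 ^ 2 * Real.cos_sq_add_sin_sq α

lemma isCompact_preimage_cylMap {K : Set E3} (hK : IsCompact K) (α : ℝ) :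
    IsCompact ((fun p : ℝ × ℝ => cylMap (p, α)) ⁻¹' K) := by
  refine Metric.isCompact_of_isClosed_isBounded
    (hK.isClosed.preimage (continuous_cylMap.comp (by fun_prop))) ?_
  obtain ⟨R, hR⟩ := hK.isBounded.exists_norm_le
  refine isBounded_iff_forall_norm_le.2 ⟨R, fun p hp => ?_⟩
  refine le_trans ?_ (hR _ hp)
  have h := norm_sq_cylMap p α
  refine max_le (abs_le_of_sq_le_sq ?_ (norm_nonneg _)) (abs_le_of_sq_le_sq ?_ (norm_nonneg _)) <;>
    rw [h] <;> nlinarith [sq_nonneg p.1, sq_nonneg p.2]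

/-- At a fixed angle the parametrization is linear in (r, z), so the slice is smooth across r = 0.
-/
lemma contDiff_sliceTest {ψ : E3 → E3} (hψ : ContDiff ℝ ∞ ψ) (α : ℝ) :
    ContDiff ℝ ∞ (sliceTest ψ α) := by
  have hc : ContDiff ℝ ∞ (fun p => ψ (cylMap (p, α))) := by
    simp only [cylMap_eq_meridianPlane]
    exact hψ.comp (meridianPlane α).contDiff
  have hi : ∀ i, ContDiff ℝ ∞ (fun p => ψ (cylMap (p, α)) i) := contDiff_euclidean.1 hc
  refine contDiff_euclidean.2 fun i => ?_
  fin_cases i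
  · exact (hi 2).neg
  · exact (contDiff_const.mul (hi 0)).add (contDiff_const.mul (hi 1))

/-- The slice keeps the e_r and e_z components and drops the e_θ component, whose square is the
defect. -/
lemma norm_sliceTest_le (ψ : E3 → E3) (α : ℝ) (p : ℝ × ℝ) :
    ‖sliceTest ψ α p‖ ≤ ‖ψ (cylMap (p, α))‖ := by
  refine abs_le_of_sq_le_sq' ?_ (norm_nonneg _) |>.2
  rw [EuclideanSpace.norm_sq_eq, EuclideanSpace.norm_sq_eq, Fin.sum_univ_three, Fin.sum_univ_two]
  simp only [Real.norm_eq_abs, sq_abs, sliceTest]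
  simp
  set a := ψ (cylMap (p, α)) 0
  set b := ψ (cylMap (p, α)) 1
  have h := Real.cos_sq_add_sin_sq α
  have e : a ^ 2 + b ^ 2 - (Real.cos α * a + Real.sin α * b) ^ 2 =
      (Real.sin α * a - Real.cos α * b) ^ 2 := by
    linear_combination (-(a ^ 2 + b ^ 2)) * h
  nlinarith [sq_nonneg (Real.sin α * a - Real.cos α * b)]

/-- The e_θ component of a curl is ∂_z ψ_r - ∂_r ψ_z and contains no angular derivative, so it can
be computed inside the slice. -/
lemma div2_sliceTest {ψ : E3 → E3} (hψ : ContDiff ℝ ∞ ψ) (α : ℝ) (p : ℝ × ℝ) :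
    div2 (sliceTest ψ α) p = -Real.sin α * dstar ψ (cylMap (p, α)) 0 +
      Real.cos α * dstar ψ (cylMap (p, α)) 1 := by
  set y := cylMap (p, α) with hy
  have hd : HasFDerivAt (fun q => ψ (cylMap (q, α))) ((fderiv ℝ ψ y).comp (meridianPlane α)) p := by
    have h1 : HasFDerivAt ψ (fderiv ℝ ψ y) (meridianPlane α p) := by
      rw [← cylMap_eq_meridianPlane]
      exact (hψ.differentiable (by simp) _).hasFDerivAt
    simp only [cylMap_eq_meridianPlane]
    exact h1.comp p (meridianPlane α).hasFDerivAt
  have hi : ∀ i : Fin 3, HasFDerivAt (fun q => ψ (cylMap (q, α)) i)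
      ((EuclideanSpace.proj i : E3 →L[ℝ] ℝ).comp ((fderiv ℝ ψ y).comp (meridianPlane α))) p :=
    fun i => (EuclideanSpace.proj i : E3 →L[ℝ] ℝ).hasFDerivAt.comp p hd
  have hs : DifferentiableAt ℝ (sliceTest ψ α) p :=
    (contDiff_sliceTest hψ α).differentiable (by simp) p
  have hcomp : ∀ (i : Fin 2) (u : ℝ × ℝ), fderiv ℝ (sliceTest ψ α) p u i =
      fderiv ℝ (fun q => sliceTest ψ α q i) p u := by
    intro i u
    have h : HasFDerivAt (fun q => sliceTest ψ α q i)
        ((EuclideanSpace.proj i : EuclideanSpace ℝ (Fin 2) →L[ℝ] ℝ).comp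
          (fderiv ℝ (sliceTest ψ α) p)) p :=
      (EuclideanSpace.proj i : EuclideanSpace ℝ (Fin 2) →L[ℝ] ℝ).hasFDerivAt.comp p hs.hasFDerivAt
    rw [h.fderiv]
    rfl
  have d0 : HasFDerivAt (fun q => sliceTest ψ α q 0) _ p := (hi 2).neg
  have d1 : HasFDerivAt (fun q => sliceTest ψ α q 1) _ p :=
    ((hi 0).const_mul (Real.cos α)).add ((hi 1).const_mul (Real.sin α))
  have e1 : meridianPlane α (1, 0) = Real.cos α • (EuclideanSpace.single 0 1 : E3) +
      Real.sin α • (EuclideanSpace.single 1 1 : E3) := by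
    ext i
    fin_cases i <;> simp [meridianPlane]
  have e2 : meridianPlane α (0, 1) = (EuclideanSpace.single 2 1 : E3) := by
    ext i
    fin_cases i <;> simp [meridianPlane]
  rw [div2, hcomp, hcomp, d0.fderiv, d1.fderiv]
  simp [e1, e2, dstar, pd]
  ring

lemma dtheta_cyl {r : ℝ} (hr : 0 < r) (α z : ℝ) :
    dtheta (cyl r α z) = r⁻¹ • (!₂[-Real.sin α, Real.cos α, 0] : E3) := by
  have h : (r * Real.cos α) ^ 2 + (r * Real.sin α) ^ 2 = r ^ 2 := by
    linear_combination r ^ 2 * Real.cos_sq_add_sin_sq α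
  ext i
  fin_cases i <;> simp [dtheta, h] <;> field_simp

/-- The Jacobian r cancels the length 1/r of dθ. -/
lemma mul_inner_mulDtheta_dstar {ψ : E3 → E3} (hψ : ContDiff ℝ ∞ ψ) (w : ℝ × ℝ → ℝ) (α : ℝ)
    {p : ℝ × ℝ} (hp : 0 < p.1) :
    p.1 * inner ℝ (mulDtheta w (cylMap (p, α))) (dstar ψ (cylMap (p, α))) =
      w p * div2 (sliceTest ψ α) p := by
  have hm : mulDtheta w (cylMap (p, α)) = w p • p.1⁻¹ • (!₂[-Real.sin α, Real.cos α, 0] : E3) := by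
    have h1 : mulDtheta w (cylMap (p, α)) =
        w (meridian (cyl p.1 α p.2)) • dtheta (cyl p.1 α p.2) := rfl
    rw [h1, meridian_cyl hp.le, dtheta_cyl hp]
  rw [hm, div2_sliceTest hψ, PiLp.inner_apply, Fin.sum_univ_three]
  simp
  field_simp

/-- The weighted variation of `w dθ` is controlled by that of `w`. -/
theorem weightedVar_mulDtheta_le {Ω : Set E3} {Ωt : Set (ℝ × ℝ)} (h : IsRevolution Ω Ωt)
    {ρ : E3 → ℝ} {ρt w : ℝ × ℝ → ℝ} (hρc : ContinuousOn ρ Ω) (hρ0 : ∀ x ∈ Ω, 0 < ρ x)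
    (hρtc : ContinuousOn ρt Ωt) (hρ : ∀ x ∈ Ω, ρ x = ρt (meridian x)) (hw : MemL2red Ωt ρt w) :
    weightedVar Ω ρ (mulDtheta w) ≤ ENNReal.ofReal (2 * Real.pi) * weightedVar2 Ωt ρt w := by
  have hpi := Real.two_pi_pos
  by_cases hS : weightedVar2 Ωt ρt w = ⊤
  · rw [hS, ENNReal.mul_top (by simpa using hpi)]
    exact le_top
  set S := (weightedVar2 Ωt ρt w).toReal with hSdef
  rw [← ENNReal.ofReal_toReal hS, ← ENNReal.ofReal_mul hpi.le]
  refine iSup₂_le fun ψ hψ => ENNReal.ofReal_le_ofReal ?_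
  obtain ⟨⟨hψc, hψs, hψΩ⟩, hψρ⟩ := hψ
  have hS0 : 0 ≤ S := ENNReal.toReal_nonneg
  -- Without integrability the integral is 0 by convention, and 0 ≤ 2πS.
  by_cases hint : Integrable (fun x => inner ℝ (mulDtheta w x) (dstar ψ x)) (volume.restrict Ω)
  swap
  · rw [integral_undef hint]; positivity
  have hwi : Integrable (fun p => ρt p / p.1 * w p ^ 2) (volume.restrict Ωt) := by
    have hσm : AEStronglyMeasurable (fun q => ρt q / q.1) (volume.restrict Ωt) :=
      ((hρtc.aestronglyMeasurable h.measurableSet).aemeasurable.div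
        measurable_fst.aemeasurable).aestronglyMeasurable
    refine ⟨hσm.mul (hw.1.pow 2), ?_⟩
    rw [hasFiniteIntegral_iff_ofReal]
    · exact hw.2
    · filter_upwards [h.ae_pos, ae_restrict_mem h.measurableSet] with p hp hpΩ
      have h1 := (h.cyl_mem_iff hp.le 0 p.2).2 hpΩ
      have h2 := hρ0 _ h1
      rw [hρ _ h1, meridian_cyl hp.le] at h2
      have : 0 < ρt p := h2
      positivity
  -- A positive lower bound for ρ on the support of ψ turns the weighted bound on w²/r into an
  -- unweighted one there.
  obtain ⟨c, hc0, hc⟩ := hψs.isCompact.exists_forall_le' (hρc.mono hψΩ) fun x hx => hρ0 x (hψΩ hx)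
  have hslice : ∀ α : ℝ, ∫ p in Ωt, w p * div2 (sliceTest ψ α) p ≤ S := by
    intro α
    -- The slice is supported on a full meridian plane, including r ≤ 0; only its part with r > 0
    -- has to lie in the interior of Ωt.
    refine integral_mul_div2_le_toReal_weightedVar2 h.ae_pos (isCompact_preimage_cylMap hψs α)
      ?_ (contDiff_sliceTest hψc α) ?_ ?_ hw.1 ?_ hS
    · intro p hp hp0
      rw [h.interior_eq]
      exact ⟨(h.cyl_mem_iff hp0.le α p.2).1 (hψΩ hp), hp0⟩
    · intro p hp
      have h1 := norm_sliceTest_le ψ α p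
      rw [image_eq_zero_of_notMem_tsupport hp, norm_zero] at h1
      exact norm_le_zero_iff.1 h1
    · intro p hp
      rw [h.interior_eq] at hp
      have h1 := (h.cyl_mem_iff hp.2.le α p.2).2 hp.1
      have h2 := (norm_sliceTest_le ψ α p).trans (hψρ _ h1)
      rw [show cylMap (p, α) = cyl p.1 α p.2 from rfl, hρ _ h1, meridian_cyl hp.2.le] at h2
      exact h2
    · refine Integrable.mono' (hwi.const_mul c⁻¹) ?_ ?_
      · refine AEStronglyMeasurable.indicator ?_
          (isCompact_preimage_cylMap hψs α).measurableSet
        exact ((hw.1.pow 2).aemeasurable.div measurable_fst.aemeasurable).aestronglyMeasurable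
      · filter_upwards [h.ae_pos, ae_restrict_mem h.measurableSet] with p hp hpΩ
        have h1 := (h.cyl_mem_iff hp.le α p.2).2 hpΩ
        have h3 : ρ (cyl p.1 α p.2) = ρt p := by rw [hρ _ h1, meridian_cyl hp.le]
        have h4 : 0 < ρt p := h3 ▸ hρ0 _ h1
        by_cases hpK : p ∈ (fun p : ℝ × ℝ => cylMap (p, α)) ⁻¹' tsupport ψ
        · rw [Set.indicator_of_mem hpK, Real.norm_of_nonneg (by positivity)]
          have h5 : c ≤ ρt p := h3 ▸ hc _ hpK
          have h6 : 1 ≤ c⁻¹ * ρt p := by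
            rw [← div_eq_inv_mul, le_div_iff₀ hc0, one_mul]; exact h5
          calc w p ^ 2 / p.1 ≤ (c⁻¹ * ρt p) * (w p ^ 2 / p.1) :=
                le_mul_of_one_le_left (by positivity) h6
            _ = _ := by ring
        · rw [Set.indicator_of_notMem hpK, norm_zero]
          positivity
  have hmp := h.measurePreserving_cylMap
  have hint' : Integrable (fun y => inner ℝ (mulDtheta w (cylMap y)) (dstar ψ (cylMap y)))
      ((radialMeasure Ωt).prod (volume.restrict (Set.Ioo (-Real.pi) Real.pi))) :=
    hmp.integrable_comp_of_integrable hint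
  have hinner : ∀ α : ℝ, ∫ p, inner ℝ (mulDtheta w (cylMap (p, α))) (dstar ψ (cylMap (p, α)))
      ∂radialMeasure Ωt = ∫ p in Ωt, w p * div2 (sliceTest ψ α) p := by
    intro α
    rw [radialMeasure, integral_withDensity_eq_integral_toReal_smul (by fun_prop)
      (ae_of_all _ fun _ => ENNReal.ofReal_lt_top)]
    refine integral_congr_ae ?_
    filter_upwards [h.ae_pos] with p hp
    rw [ENNReal.toReal_ofReal hp.le, smul_eq_mul, mul_inner_mulDtheta_dstar hψc w α hp]
  rw [← hmp.map_eq, integral_map hmp.measurable.aemeasurable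
    (by rw [hmp.map_eq]; exact hint.1), integral_prod_symm _ hint']
  simp only [hinner]
  have hint2 := hint'.integral_prod_right
  simp only [hinner] at hint2
  calc _ ≤ ∫ α in Set.Ioo (-Real.pi) Real.pi, S :=
        integral_mono hint2 (integrable_const _) hslice
    _ = 2 * Real.pi * S := by
      rw [integral_const, measureReal_restrict_apply_univ, Real.volume_real_Ioo_of_le (by linarith),
        smul_eq_mul]
      ring

end Slices

/-! ### The lift r^{1/2} W dθ as a multiple of an isometry. -/

section LiftL2

/-- The form `r^{1/2} W(r, z) dθ`; up to a factor, `W ↦ liftForm W` is an isometry from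
`L²(dr dz)` into `L²(dx)`. -/
def liftForm (W : ℝ × ℝ → ℝ) (x : E3) : E3 :=
  (W (meridian x) * Real.sqrt (meridian x).1) • dtheta x

lemma norm_dtheta_sq {x : E3} (hx : 0 < (meridian x).1) :
    ‖dtheta x‖ ^ 2 = ((meridian x).1 ^ 2)⁻¹ := by
  have h := meridian_fst_sq x
  rw [EuclideanSpace.norm_sq_eq, Fin.sum_univ_three]
  simp only [Real.norm_eq_abs, sq_abs]
  simp [dtheta, ← h]
  field_simp
  linear_combination -h

/-- The two factors r^{1/2} and |dθ|² = r^{-2} leave 1/r, which the volume element r dr dz dα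
removes. -/
lemma inner_liftForm (A B : ℝ × ℝ → ℝ) {x : E3} (hx : 0 < (meridian x).1) :
    inner ℝ (liftForm A x) (liftForm B x) =
      A (meridian x) * B (meridian x) / (meridian x).1 := by
  rw [liftForm, liftForm, inner_smul_left, inner_smul_right, real_inner_self_eq_norm_sq,
    norm_dtheta_sq hx, conj_trivial]
  have h := Real.mul_self_sqrt hx.le
  field_simp
  linear_combination A (meridian x) * B (meridian x) * h

lemma measurable_dtheta : Measurable dtheta := by
  unfold dtheta
  refine (PiLp.continuous_toLp 2 _).measurable.comp (measurable_pi_iff.2 fun i => ?_)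
  have h : ∀ j : Fin 3, Measurable fun x : E3 => x j := fun j =>
    (EuclideanSpace.proj j : E3 →L[ℝ] ℝ).continuous.measurable
  fin_cases i
  · exact (h 1).neg.div (((h 0).pow_const 2).add ((h 1).pow_const 2))
  · exact (h 0).div (((h 0).pow_const 2).add ((h 1).pow_const 2))
  · exact measurable_const

variable {Ω : Set E3} {Ωt : Set (ℝ × ℝ)}

namespace IsRevolution

lemma quasiMeasurePreserving_meridian (h : IsRevolution Ω Ωt) :
    Measure.QuasiMeasurePreserving meridian (volume.restrict Ω) (volume.restrict Ωt) := by
  refine ⟨continuous_meridian.measurable, ?_⟩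
  rw [h.map_meridian]
  exact (withDensity_absolutelyContinuous _ _).smul_left _

lemma ae_meridian (h : IsRevolution Ω Ωt) {P : ℝ × ℝ → Prop}
    (hP : ∀ᵐ p ∂volume.restrict Ωt, P p) : ∀ᵐ x ∂volume.restrict Ω, P (meridian x) :=
  h.quasiMeasurePreserving_meridian.ae hP

lemma aestronglyMeasurable_map (h : IsRevolution Ω Ωt) {A : ℝ × ℝ → ℝ}
    (hA : AEStronglyMeasurable A (volume.restrict Ωt)) :
    AEStronglyMeasurable (fun p => A p / p.1) ((volume.restrict Ω).map meridian) :=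
  ((hA.aemeasurable.div measurable_fst.aemeasurable).aestronglyMeasurable).mono_ac
    h.quasiMeasurePreserving_meridian.absolutelyContinuous

lemma integral_meridian_div (h : IsRevolution Ω Ωt) {A : ℝ × ℝ → ℝ}
    (hA : AEStronglyMeasurable A (volume.restrict Ωt)) :
    ∫ x in Ω, A (meridian x) / (meridian x).1 = 2 * Real.pi * ∫ p in Ωt, A p := by
  have h1 := integral_map continuous_meridian.aemeasurable (h.aestronglyMeasurable_map hA)
  rw [← h1, h.map_meridian, integral_smul_measure, ENNReal.toReal_ofReal Real.two_pi_pos.le,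
    radialMeasure, integral_withDensity_eq_integral_toReal_smul (by fun_prop)
      (ae_of_all _ fun _ => ENNReal.ofReal_lt_top), smul_eq_mul]
  congr 1
  refine integral_congr_ae ?_
  filter_upwards [h.ae_pos] with p hp
  rw [ENNReal.toReal_ofReal hp.le, smul_eq_mul, mul_div_cancel₀ _ hp.ne']

lemma integrable_meridian_div_iff (h : IsRevolution Ω Ωt) {A : ℝ × ℝ → ℝ}
    (hA : AEStronglyMeasurable A (volume.restrict Ωt)) :
    Integrable (fun x => A (meridian x) / (meridian x).1) (volume.restrict Ω) ↔
      Integrable A (volume.restrict Ωt) := by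
  have h1 := integrable_map_measure (h.aestronglyMeasurable_map hA)
    continuous_meridian.aemeasurable
  rw [Function.comp_def] at h1
  rw [← h1, h.map_meridian, integrable_smul_measure (by simpa using Real.pi_pos)
    ENNReal.ofReal_ne_top, radialMeasure, integrable_withDensity_iff_integrable_smul' (by fun_prop)
      (ae_of_all _ fun _ => ENNReal.ofReal_lt_top)]
  refine integrable_congr ?_
  filter_upwards [h.ae_pos] with p hp
  rw [ENNReal.toReal_ofReal hp.le, smul_eq_mul, mul_div_cancel₀ _ hp.ne']

lemma integral_inner_liftForm (h : IsRevolution Ω Ωt) {A B : ℝ × ℝ → ℝ}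
    (hA : AEStronglyMeasurable A (volume.restrict Ωt))
    (hB : AEStronglyMeasurable B (volume.restrict Ωt)) :
    ∫ x in Ω, inner ℝ (liftForm A x) (liftForm B x) = 2 * Real.pi * ∫ p in Ωt, A p * B p := by
  rw [← h.integral_meridian_div (A := fun p => A p * B p) (hA.mul hB)]
  refine integral_congr_ae ?_
  filter_upwards [h.ae_meridian_pos] with x hx using inner_liftForm A B hx

lemma aestronglyMeasurable_liftForm (h : IsRevolution Ω Ωt) {A : ℝ × ℝ → ℝ}
    (hA : AEStronglyMeasurable A (volume.restrict Ωt)) :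
    AEStronglyMeasurable (liftForm A) (volume.restrict Ω) := by
  have h1 := hA.comp_quasiMeasurePreserving h.quasiMeasurePreserving_meridian
  have h2 : AEStronglyMeasurable (fun x => Real.sqrt (meridian x).1) (volume.restrict Ω) :=
    (Real.continuous_sqrt.comp (continuous_fst.comp continuous_meridian)).aestronglyMeasurable
  exact (h1.mul h2).smul measurable_dtheta.aestronglyMeasurable

lemma memLp_liftForm_iff (h : IsRevolution Ω Ωt) {A : ℝ × ℝ → ℝ}
    (hA : AEStronglyMeasurable A (volume.restrict Ωt)) :
    MemLp (liftForm A) 2 (volume.restrict Ω) ↔ MemLp A 2 (volume.restrict Ωt) := by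
  rw [memLp_two_iff_integrable_sq_norm (h.aestronglyMeasurable_liftForm hA),
    memLp_two_iff_integrable_sq_norm hA,
    ← h.integrable_meridian_div_iff (A := fun p => ‖A p‖ ^ 2) (hA.norm.pow 2)]
  refine integrable_congr ?_
  filter_upwards [h.ae_meridian_pos] with x hx
  rw [← real_inner_self_eq_norm_sq, inner_liftForm A A hx]
  simp [sq]

lemma eLpNorm_liftForm (h : IsRevolution Ω Ωt) {A : ℝ × ℝ → ℝ}
    (hA : MemLp A 2 (volume.restrict Ωt)) :
    eLpNorm (liftForm A) 2 (volume.restrict Ω) =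
      ENNReal.ofReal (Real.sqrt (2 * Real.pi)) * eLpNorm A 2 (volume.restrict Ωt) := by
  have hL := (h.memLp_liftForm_iff hA.1).2 hA
  rw [← ENNReal.ofReal_toReal hL.2.ne, ← ENNReal.ofReal_toReal hA.2.ne,
    ← ENNReal.ofReal_mul (Real.sqrt_nonneg _)]
  congr 1
  rw [← Lp.norm_toLp _ hL, ← Lp.norm_toLp _ hA, ← sq_eq_sq₀ (norm_nonneg _) (by positivity),
    mul_pow, Real.sq_sqrt Real.two_pi_pos.le, ← real_inner_self_eq_norm_sq,
    ← real_inner_self_eq_norm_sq, inner_toLp_eq_integral, inner_toLp_eq_integral,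
    h.integral_inner_liftForm hA.1 hA.1]
  simp [sq]

/-- If `f(r, z)` is measurable on `Ω`, then `f` is measurable on `Ωt`. -/
lemma aestronglyMeasurable_of_comp_meridian (h : IsRevolution Ω Ωt) {f : ℝ × ℝ → ℝ}
    (hf : AEStronglyMeasurable (fun x => f (meridian x)) (volume.restrict Ω)) :
    AEStronglyMeasurable f (volume.restrict Ωt) := by
  have h1 := hf.comp_measurePreserving h.measurePreserving_cylMap
  have hpos : ∀ᵐ p ∂radialMeasure Ωt, 0 < p.1 :=
    (withDensity_absolutelyContinuous _ _).ae_le h.ae_pos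
  have h2 : AEStronglyMeasurable (fun y : (ℝ × ℝ) × ℝ => f y.1) ((radialMeasure Ωt).prod
      (volume.restrict (Set.Ioo (-Real.pi) Real.pi))) := by
    refine h1.congr ?_
    filter_upwards [Measure.quasiMeasurePreserving_fst.ae hpos] with y hy
    simp only [Function.comp_apply, cylMap]
    rw [meridian_cyl hy.le]
  have h3 : AEStronglyMeasurable f (radialMeasure Ωt) := by
    refine h2.of_comp_fst ?_
    rw [Ne, Measure.restrict_eq_zero, Real.volume_Ioo]
    simp [Real.pi_pos]
  -- The density r is positive almost everywhere, so dr dz is absolutely continuous with respect to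
  -- r dr dz.
  refine h3.mono_ac (withDensity_absolutelyContinuous' (by fun_prop) ?_)
  filter_upwards [h.ae_pos] with p hp
  simpa using hp

end IsRevolution

end LiftL2

/-! ### Transfer of the certificate to space and conclusion. -/

theorem lemma14 (Ω : Set E3) (ρ : E3 → ℝ) (Φ : E3 → E3)
    (Ωt : Set (ℝ × ℝ)) (ρt φ : ℝ × ℝ → ℝ)
    (hΩ_open : IsOpen Ω) (hρ_cont : ContinuousOn ρ Ω) (hΦ : MemL2rho Ω ρ Φ)
    (hΩt : ∀ p ∈ Ωt, 0 ≤ p.1) (hρt : ∀ p ∈ Ωt, 0 < ρt p)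
    (hΩ : Ω = {x | ∃ r z α : ℝ, (r, z) ∈ Ωt ∧ x = cyl r α z})
    (hρ : ∀ r z α : ℝ, (r, z) ∈ Ωt → ρ (cyl r α z) = ρt (r, z))
    (hφ : ∀ r z α : ℝ, (r, z) ∈ Ωt → 0 < r →
      Φ (cyl r α z) = φ (r, z) • dtheta (cyl r α z)) :
    ∃ (v₀ : E3 → E3) (w₀ : ℝ × ℝ → ℝ),
      IsMinimizerG Ω ρ Φ v₀ ∧
      (∀ v : E3 → E3, IsMinimizerG Ω ρ Φ v → v =ᵐ[MeasureTheory.volume.restrict Ω] v₀) ∧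
      IsMinimizerGred Ωt ρt φ w₀ ∧
      (∀ w : ℝ × ℝ → ℝ, IsMinimizerGred Ωt ρt φ w →
        w =ᵐ[MeasureTheory.volume.restrict Ωt] w₀) ∧
      v₀ =ᵐ[MeasureTheory.volume.restrict Ω] mulDtheta w₀ := by
  have h : IsRevolution Ω Ωt := ⟨hΩ_open, hΩt, hΩ⟩
  have hm := h.measurableSet
  have hρm : ∀ x ∈ Ω, ρ x = ρt (meridian x) := by
    intro x hx
    obtain ⟨α, hα⟩ := exists_eq_cyl x
    conv_lhs => rw [hα]
    exact hρ _ _ _ ((h.mem_iff x).1 hx)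
  have hρ0 : ∀ x ∈ Ω, 0 < ρ x := fun x hx => by
    rw [hρm x hx]
    exact hρt _ ((h.mem_iff x).1 hx)
  have hΦm : ∀ x ∈ Ω, 0 < (meridian x).1 → Φ x = φ (meridian x) • dtheta x := by
    intro x hx hx0
    obtain ⟨α, hα⟩ := exists_eq_cyl x
    have := hφ (meridian x).1 (meridian x).2 α ((h.mem_iff x).1 hx) hx0
    rwa [← hα] at this
  have hρtc : ContinuousOn ρt Ωt := by
    have hc : ContinuousOn (fun p : ℝ × ℝ => ρ (cylMap (p, 0))) Ωt :=
      hρ_cont.comp (continuous_cylMap.comp (by fun_prop)).continuousOn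
        fun p hp => (h.cyl_mem_iff (hΩt p hp) 0 p.2).2 hp
    exact hc.congr fun p hp => (hρ p.1 p.2 0 hp).symm
  have hpos : ∀ q ∈ interior Ωt, 0 < q.1 := fun q hq => by
    rw [h.interior_eq] at hq
    exact hq.2
  have hmem : ∀ᵐ x ∂volume.restrict Ω, x ∈ Ω := ae_restrict_mem hΩ_open.measurableSet
  have hr := h.ae_meridian_pos
  -- Measurability of φ is inherited from Φ through φ = r² ⟨Φ, dθ⟩.
  have hφm : AEStronglyMeasurable φ (volume.restrict Ωt) := by
    refine h.aestronglyMeasurable_of_comp_meridian ?_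
    have h1 : AEStronglyMeasurable (fun x => inner ℝ (Φ x) (dtheta x) * (meridian x).1 ^ 2)
        (volume.restrict Ω) :=
      (hΦ.1.aestronglyMeasurable.inner measurable_dtheta.aestronglyMeasurable).mul
        ((continuous_fst.comp continuous_meridian).pow 2).aestronglyMeasurable
    refine h1.congr ?_
    filter_upwards [hmem, hr] with x hx hx0
    rw [hΦm x hx hx0, inner_smul_left, real_inner_self_eq_norm_sq, norm_dtheta_sq hx0, conj_trivial,
      mul_assoc, inv_mul_cancel₀ (by positivity), mul_one]
  have hσm : AEStronglyMeasurable (fun q => Real.sqrt (ρt q / q.1)) (volume.restrict Ωt) :=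
    (((hρtc.aestronglyMeasurable hm).aemeasurable.div
      measurable_fst.aemeasurable).sqrt).aestronglyMeasurable
  set F₂ : ℝ × ℝ → ℝ := fun q => Real.sqrt (ρt q / q.1) • φ q with hF₂
  have hF₂m : AEStronglyMeasurable F₂ (volume.restrict Ωt) := hσm.smul hφm
  -- The planar rescaling followed by the lift agrees with the spatial rescaling; this identity
  -- matches the two problems.
  have hsqrt : ∀ x ∈ Ω, 0 < (meridian x).1 →
      Real.sqrt (ρt (meridian x) / (meridian x).1) * Real.sqrt (meridian x).1 =
        Real.sqrt (ρ x) := by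
    intro x hx hx0
    rw [← Real.sqrt_mul' _ hx0.le, div_mul_cancel₀ _ hx0.ne', hρm x hx]
  have hF₃ : (fun x => Real.sqrt (ρ x) • Φ x) =ᵐ[volume.restrict Ω] liftForm F₂ := by
    filter_upwards [hmem, hr] with x hx hx0
    rw [liftForm, hΦm x hx hx0, ← hsqrt x hx hx0, smul_smul]
    simp only [hF₂, smul_eq_mul]
    ring_nf
  have hF₃L := (memL2rho_iff hΩ_open hρ_cont hρ0).1 hΦ
  have hF₂L : MemLp F₂ 2 (volume.restrict Ωt) :=
    (h.memLp_liftForm_iff hF₂m).1 ((memLp_congr_ae hF₃).1 hF₃L)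
  have hD₂ := memLp_of_mem_dualFields2 hm hpos hρtc hρt
  obtain ⟨p, hp⟩ := exists_isDualCertificate hD₂ (convex_dualFields2 Ωt ρt)
    ⟨_, 0, zero_mem_admissible fun q hq => (hρt q (interior_subset hq)).le, rfl⟩ hF₂L
  -- This undoes the rescaling in the optimality relation u = f - p/2.
  set w₀ : ℝ × ℝ → ℝ := fun q => φ q - (Real.sqrt (ρt q / q.1))⁻¹ * ((1 / 2 : ℝ) • p q) with hw₀
  have hw₀eq : ∀ᵐ q ∂volume.restrict Ωt,
      Real.sqrt (ρt q / q.1) • w₀ q = F₂ q - (1 / 2 : ℝ) • p q := by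
    filter_upwards [h.ae_pos, ae_restrict_mem hm] with q hq hqm
    have hne : Real.sqrt (ρt q / q.1) ≠ 0 := (Real.sqrt_pos.2 (div_pos (hρt q hqm) hq)).ne'
    rw [hw₀, hF₂]
    simp only [smul_eq_mul, mul_sub, mul_inv_cancel_left₀ hne]
  obtain ⟨hmin, huniq, hQ0, hvar⟩ :=
    isMinimizerGred_of_isDualCertificate hm hpos hρtc hρt h.ae_pos hF₂L hp hw₀eq
  have hv₀eq : ∀ᵐ x ∂volume.restrict Ω, Real.sqrt (ρ x) • mulDtheta w₀ x =
      Real.sqrt (ρ x) • Φ x - (1 / 2 : ℝ) • liftForm p x := by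
    filter_upwards [hmem, hr, hF₃, h.ae_meridian hw₀eq] with x hx hx0 hF hw
    have h1 : mulDtheta w₀ x = w₀ (meridian x) • dtheta x := rfl
    rw [hF, h1, smul_smul, ← hsqrt x hx hx0, liftForm, liftForm, smul_smul, ← sub_smul]
    congr 1
    rw [smul_eq_mul, smul_eq_mul] at hw
    linear_combination Real.sqrt (meridian x).1 * hw
  set V₂ : ℝ × ℝ → ℝ := fun q => F₂ q - (1 / 2 : ℝ) • p q with hV₂
  have hV₂m : AEStronglyMeasurable V₂ (volume.restrict Ωt) :=
    hF₂m.sub (hp.memLp.1.const_smul (1 / 2 : ℝ))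
  have hcert : IsDualCertificate (volume.restrict Ω) (dualFields Ω ρ)
      (fun x => Real.sqrt (ρ x) • Φ x) (liftForm p) := by
    refine ⟨(h.memLp_liftForm_iff hp.memLp.1).2 hp.memLp, fun ε hε => ?_, ?_⟩
    · have hs : 0 < Real.sqrt (2 * Real.pi) := Real.sqrt_pos.2 Real.two_pi_pos
      obtain ⟨_, ⟨ξ, hξ, rfl⟩, hk⟩ := hp.approx (ε / Real.sqrt (2 * Real.pi)) (by positivity)
      refine ⟨_, ⟨liftTest ξ,
        liftTest_mem_admissible h hρm (fun x hx => (hρ0 x hx).le) hξ, rfl⟩, ?_⟩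
      have hkL := hp.memLp.sub (hD₂ _ ⟨ξ, hξ, rfl⟩)
      -- The lift of (ρt/r)^{-1/2} div ξ is exactly the element of `dualFields` given by the rotated
      -- field, so approximation of p survives lifting.
      have he : liftForm p - (fun x => (Real.sqrt (ρ x))⁻¹ • dstar (liftTest ξ) x)
          =ᵐ[volume.restrict Ω]
          liftForm (p - fun q => (Real.sqrt (ρt q / q.1))⁻¹ • div2 ξ q) := by
        filter_upwards [hmem, hr] with x hx hx0
        have hne : Real.sqrt (ρ x) ≠ 0 := (Real.sqrt_pos.2 (hρ0 x hx)).ne'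
        have h1 := hsqrt x hx hx0
        have h2 := Real.mul_self_sqrt hx0.le
        simp only [Pi.sub_apply, liftForm]
        rw [dstar_liftTest hξ.1.1 hx0, smul_smul, ← sub_smul]
        congr 1
        rw [← h1] at hne ⊢
        have hne1 := left_ne_zero_of_mul hne
        have hne2 := right_ne_zero_of_mul hne
        rw [smul_eq_mul, sub_mul, mul_inv]
        congr 1
        field_simp
        linear_combination -div2 ξ (meridian x) * h2
      rw [eLpNorm_congr_ae he, h.eLpNorm_liftForm hkL]
      calc _ < ENNReal.ofReal (Real.sqrt (2 * Real.pi)) *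
            ENNReal.ofReal (ε / Real.sqrt (2 * Real.pi)) :=
            ENNReal.mul_lt_mul_right (by simpa using hs) ENNReal.ofReal_ne_top hk
        _ = ENNReal.ofReal ε := by
          rw [← ENNReal.ofReal_mul hs.le, mul_div_cancel₀ _ hs.ne']
    · rintro _ ⟨ψ, hψ, rfl⟩
      have e1 : ∫ x in Ω, inner ℝ (Real.sqrt (ρ x) • Φ x - (1 / 2 : ℝ) • liftForm p x)
          ((Real.sqrt (ρ x))⁻¹ • dstar ψ x) = ∫ x in Ω, inner ℝ (mulDtheta w₀ x) (dstar ψ x) := by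
        refine integral_congr_ae ?_
        filter_upwards [hmem, hv₀eq] with x hx hv
        rw [← hv, inner_sqrt_smul_inv_sqrt_smul (hρ0 x hx)]
      have e2 : ∫ x in Ω, inner ℝ (Real.sqrt (ρ x) • Φ x - (1 / 2 : ℝ) • liftForm p x)
          (liftForm p x) = 2 * Real.pi * ∫ q in Ωt, inner ℝ (V₂ q) (p q) := by
        have e3 : ∫ q in Ωt, inner ℝ (V₂ q) (p q) = ∫ q in Ωt, V₂ q * p q := by
          simp [mul_comm]
        rw [e3, ← h.integral_inner_liftForm hV₂m hp.memLp.1]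
        refine integral_congr_ae ?_
        filter_upwards [hF₃] with x hF
        have e4 : liftForm V₂ x = liftForm F₂ x - (1 / 2 : ℝ) • liftForm p x := by
          simp only [liftForm, hV₂, smul_smul, ← sub_smul, smul_eq_mul]
          ring_nf
        rw [e4, ← hF]
      -- The right-hand side is nonnegative, so the comparison may be made in [0, ∞], where it goes
      -- through the variation of w₀ dθ, then 2π times that of w₀.
      rw [e1, e2, ← ENNReal.ofReal_le_ofReal_iff (mul_nonneg Real.two_pi_pos.le hQ0)]
      calc _ ≤ weightedVar Ω ρ (mulDtheta w₀) :=
            le_iSup₂_of_le (f := fun (ψ : E3 → E3)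
              (_ : IsTest Ω ψ ∧ ∀ x ∈ Ω, ‖ψ x‖ ≤ ρ x) =>
              ENNReal.ofReal (∫ x in Ω, inner ℝ (mulDtheta w₀ x) (dstar ψ x))) ψ hψ le_rfl
        _ ≤ ENNReal.ofReal (2 * Real.pi) * weightedVar2 Ωt ρt w₀ :=
            weightedVar_mulDtheta_le h hρ_cont hρ0 hρtc hρm hmin.1
        _ ≤ _ := by
            rw [ENNReal.ofReal_mul Real.two_pi_pos.le]
            gcongr
  obtain ⟨hminG, huniqG⟩ :=
    isMinimizerG_of_isDualCertificate hΩ_open hρ_cont hρ0 hΦ hcert hv₀eq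
  exact ⟨mulDtheta w₀, w₀, hminG, huniqG, hmin, huniq, Filter.EventuallyEq.rfl⟩

end
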